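/- **Setting.** Let $V$ be a finite set and let $B$ be a stationary Bratteli diagram: each level $1,2,\dots$ is a copy of $V$, the top vertex $v_0$ is joined to each vertex of level $1$ by at least one edge, and for every $N\ge 1$ there are $F_{vw}\in\mathbb Z_{\ge 0}$ edges from the vertex $w$ of level $N$ to the vertex $v$ of level $N+1$, where the incidence matrix $F$ has no zero row and no zero column. Put $A=F^T$. Let $X_B$ be the space of infinite paths starting at $v_0$ (with the topology induced from the product of the discrete edge sets), and let $\mathcal R$ be the tail equivalence relation on $X_B$: two paths are equivalent if they eventually coincide. For vertices write $w\to v$ if $w=v$ or some downward path leads from (a copy of) $w$ to (a copy of) $v$. A *class* is an equivalence class for the relation "$w\to v$ and $v\to w$". Let $\mu$ be an infinite, non-atomic (every point has measure zero), ergodic, $\mathcal R$-invariant Borel measure on $X_B$ defined by an eigenvalue $\lambda$ of $A$ and a class $\alpha$, with reduced vector $x$. This means the following. * $\mu(X_B\setminus X_\alpha)=0$, where $X_\alpha$ is the set of paths that eventually pass only through vertices of $\alpha$. * Let $V_f=\{v_1,\dots,v_n\}$ be the set of all vertices $v$ such that $v\to a$ for some $a\in\alpha$ and every cylinder set ending in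 $v$ has finite $\mu$-measure, numbered so that $v_{m+1},\dots,v_n$ are exactly the vertices of $\alpha$. Let $A_f$ be the restriction of $A$ to $V_f\times V_f$. Then $x=(x_1,\dots,x_n)^T$ has positive entries and $A_fx=\lambda x$. * Every cylinder set that ends in the vertex $v_j\in\alpha$ of level $N$ has measure $x_j/\lambda^{N-1}$. (The measures defined by a non-distinguished eigenvalue are of this kind. No normalization of $x$ is required.) The measure $\mu$ is regarded as a measure on its support $\operatorname{supp}\mu$. It is called *good* if for all clopen $U,W\subset \operatorname{supp}\mu$ with $\mu(U)<\mu(W)$ there is a clopen set $W'\subset W$ with $\mu(W')=\mu(U)$. Let $S(\mu)$ be the set of all finite values of $\mu$ on clopen subsets of $\operatorname{supp}\mu$. **Statement.** 1. $\mu$ is good if and only if there exists $R\in\mathbb N=\{0,1,2,\dots\}$ such that $\lambda^Rx_1,\dots,\lambda^Rx_m$ belong to the additive subgroup of $\mathbb R$ generated by $x_{m+1},\dots,x_n$. 2. Suppose that $S(\mu)\subset\mathbb Q$ and $x=\left(\frac{p_1}{q},\dots,\frac{p_n}{q}\right)^T$ with positive integers $p_1,\dots,p_n,q$ such that $\gcd(p_1,\dots,p_n)=1$.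 Then $\lambda$ is a positive integer, and $\mu$ is good if and only if $\gcd(p_{m+1},\dots,p_n)\mid\lambda^R$ for some $R\in\mathbb N$. -/

import Mathlib

open MeasureTheory Set

universe u

/-- A stationary Bratteli diagram on the finite vertex set `V`: every level `1, 2, …` is a copy of
`V`; `hat v ≥ 1` edges join the top vertex to the vertex `v` of level `1`; for each level,
`F v w` edges join the vertex `w` of that level to the vertex `v` of the next level. Every vertex
has an incoming and an outgoing edge. `F` is the incidence matrix. -/
structure StationaryBratteliDiagram (V : Type u) where
  F : Matrix V V ℕ
  hat : V → ℕ
  hat_pos : ∀ v, 0 < hat v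
  exists_incoming : ∀ v, ∃ w, 0 < F v w
  exists_outgoing : ∀ w, ∃ v, 0 < F v w

namespace StationaryBratteliDiagram

variable {V : Type u}

/-- The matrix `A`, the transpose of the incidence matrix, with real entries. -/
def A (B : StationaryBratteliDiagram V) : Matrix V V ℝ := B.F.transpose.map (fun k : ℕ => (k : ℝ))

/-- Edges from the top vertex to level `1`. -/
def TopEdge (B : StationaryBratteliDiagram V) : Type u := Σ v : V, Fin (B.hat v)

/-- Edges between two consecutive levels: source, range, and a label. -/
def Edge (B : StationaryBratteliDiagram V) : Type u := Σ w : V, Σ v : V, Fin (B.F v w)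

/-- The source of an edge. -/
def Edge.src {B : StationaryBratteliDiagram V} (e : B.Edge) : V := e.1

/-- The range of an edge. -/
def Edge.rng {B : StationaryBratteliDiagram V} (e : B.Edge) : V := e.2.1

instance (B : StationaryBratteliDiagram V) : TopologicalSpace B.TopEdge := ⊥
instance (B : StationaryBratteliDiagram V) : DiscreteTopology B.TopEdge := ⟨rfl⟩
instance (B : StationaryBratteliDiagram V) : TopologicalSpace B.Edge := ⊥
instance (B : StationaryBratteliDiagram V) : DiscreteTopology B.Edge := ⟨rfl⟩

/-- The space `X_B` of infinite paths starting at the top vertex. -/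
def PathSpace (B : StationaryBratteliDiagram V) : Type u :=
  {p : B.TopEdge × (ℕ → B.Edge) //
    (p.2 0).src = p.1.1 ∧ ∀ n, (p.2 (n + 1)).src = (p.2 n).rng}

/-- `X_B` carries the topology induced from the product of the discrete edge sets. -/
instance (B : StationaryBratteliDiagram V) : TopologicalSpace B.PathSpace :=
  inferInstanceAs (TopologicalSpace (Subtype _))

instance (B : StationaryBratteliDiagram V) : MeasurableSpace B.PathSpace := borel _
instance (B : StationaryBratteliDiagram V) : BorelSpace B.PathSpace := ⟨rfl⟩

namespace PathSpace

variable {B : StationaryBratteliDiagram V}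

/-- The edge of the path from the top vertex to level `1`. -/
def top (p : B.PathSpace) : B.TopEdge := p.1.1

/-- The edge of the path from level `n + 1` to level `n + 2`. -/
def edge (p : B.PathSpace) (n : ℕ) : B.Edge := p.1.2 n

/-- The vertex of the path on level `n + 1`. -/
def vertex (p : B.PathSpace) : ℕ → V
  | 0 => p.top.1
  | n + 1 => (p.edge n).rng

/-- The cylinder set of all paths that agree with `p` from the top vertex to level `N + 1`;
it ends in the vertex `p.vertex N` of level `N + 1`. -/
def cylinder (p : B.PathSpace) (N : ℕ) : Set B.PathSpace :=
  {q | q.top = p.top ∧ ∀ n < N, q.edge n = p.edge n}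

/-- The tail (cofinal) equivalence relation `𝓡`. -/
def Tail (p q : B.PathSpace) : Prop := ∃ N, ∀ n ≥ N, p.edge n = q.edge n

end PathSpace

/-- `𝓡`-invariance: every Borel automorphism moving points only inside their `𝓡`-classes
preserves the measure. -/
def IsTailInvariant (B : StationaryBratteliDiagram V) (μ : Measure B.PathSpace) : Prop :=
  ∀ φ : B.PathSpace ≃ᵐ B.PathSpace, (∀ p, PathSpace.Tail p (φ p)) → μ.map φ = μ

/-- Ergodicity: every `𝓡`-saturated Borel set is null or conull. -/
def IsTailErgodic (B : StationaryBratteliDiagram V) (μ : Measure B.PathSpace) : Prop :=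
  ∀ S : Set B.PathSpace, MeasurableSet S →
    (∀ p q, PathSpace.Tail p q → p ∈ S → q ∈ S) → μ S = 0 ∨ μ Sᶜ = 0

/-- There is a downward path (possibly of length `0`) from the vertex `w` to the vertex `v`. -/
def Reaches (B : StationaryBratteliDiagram V) (w v : V) : Prop :=
  Relation.ReflTransGen (fun a b : V => 0 < B.F b a) w v

/-- `α` is a class of vertices: an equivalence class of mutual reachability. -/
def IsVertexClass (B : StationaryBratteliDiagram V) (α : Finset V) : Prop :=
  ∃ a : V, ∀ v : V, v ∈ α ↔ B.Reaches a v ∧ B.Reaches v a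

/-- `X_α`, the set of paths that eventually pass only through vertices of `α`. -/
def eventuallyIn (B : StationaryBratteliDiagram V) (α : Finset V) : Set B.PathSpace :=
  {p | ∃ N, ∀ n ≥ N, p.vertex n ∈ α}

open Classical in
/-- The vertices of the subdiagram `B_f`: those from which `α` can be reached and such that all
cylinder sets ending in them have finite measure. -/
noncomputable def finiteVertices [Fintype V] (B : StationaryBratteliDiagram V)
    (μ : Measure B.PathSpace) (α : Finset V) : Finset V :=
  Finset.univ.filter fun v => (∃ a ∈ α, B.Reaches v a) ∧
    ∀ (p : B.PathSpace) (N : ℕ), p.vertex N = v → μ (p.cylinder N) < ⊤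

/-- `μ` is the measure defined by the eigenvalue `lam` and the vertex class `α`, and `x` (of which
only the entries on the vertices of `B_f` matter) is its reduced vector: `μ` is the extension to
`X_α` of the measure generated by `lam` and `x` on the simple subdiagram with vertex set `α`, and
`x` is the positive eigenvector of the matrix `A_f` of `B_f` for `lam`. -/
structure IsDefinedBy [Fintype V] (B : StationaryBratteliDiagram V)
    (μ : Measure B.PathSpace) (α : Finset V) (lam : ℝ) (x : V → ℝ) : Prop where
  isVertexClass : B.IsVertexClass α
  compl_null : μ (B.eventuallyIn α)ᶜ = 0
  measure_cylinder : ∀ (p : B.PathSpace) (N : ℕ), p.vertex N ∈ α →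
    μ (p.cylinder N) = ENNReal.ofReal (x (p.vertex N) / lam ^ N)
  pos : ∀ v ∈ B.finiteVertices μ α, 0 < x v
  eigen : ∀ v ∈ B.finiteVertices μ α,
    ∑ w ∈ B.finiteVertices μ α, B.A v w * x w = lam * x v

end StationaryBratteliDiagram

/-- A measure regarded as a measure on its topological support. -/
noncomputable def onSupport {X : Type u} [TopologicalSpace X] [MeasurableSpace X]
    (μ : Measure X) : Measure μ.support :=
  μ.comap Subtype.val

/-- A measure is good if every clopen `V` is good: each value of the measure on clopen sets that is
smaller than the measure of `V` is attained on some clopen subset of `V`. -/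
def IsGoodMeasure {X : Type u} [TopologicalSpace X] [MeasurableSpace X] (μ : Measure X) : Prop :=
  ∀ V : Set X, IsClopen V → ∀ U : Set X, IsClopen U → μ U < μ V →
    ∃ W : Set X, IsClopen W ∧ W ⊆ V ∧ μ W = μ U

/-- The clopen values set `S(μ)`: all finite values of `μ` on clopen sets. -/
def clopenValues {X : Type u} [TopologicalSpace X] [MeasurableSpace X] (μ : Measure X) : Set ℝ :=
  {r | ∃ U : Set X, IsClopen U ∧ μ U ≠ ⊤ ∧ r = (μ U).toReal}

/-! The support of `μ` consists of the paths all of whose vertices reach `α`; its clopen subsets are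
traces of finite unions of cylinders of one level. If such a set has finite measure, its cylinders
end in `V_f`, and a cylinder ending in `v` has measure `x v / lam ^ N`, where `N = 0` stands for
level `1` (`measure_cylinder_eq`). Let `G` be the group generated by the entries of `x` on `α`. The
eigenvector equation restricts to `α`, so `lam * G ⊆ G`.

Necessity: since the total mass is infinite, the paths of the support that are in `α` at a late
level `N` have mass above `x v`. Goodness puts a clopen set of measure `x v` among them. It is a
finite union of cylinders ending in `α`, hence `lam ^ L * x v ∈ G` for some `L`.

Sufficiency: let `t` be the measure of the smaller set. At a late level `M` one has `lam ^ M * t = ∑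
c a * x a` with integers `c a`, possibly negative, while the part of the larger set already in `α`
at level `M` still has measure above `t`. Moving down `L` levels replaces `c` by `∑ a, c a * walks L
a b`. Ergodicity makes the matrix on `α` primitive, so for large `L` the sign of such a sum is
governed by the pairing of the coefficients with `x` (`eventually_sum_mul_walks_pos`). Applied to
`c` and to the surplus of available cylinders over `c`, this gives positive multiplicities that fit
inside the larger set; the selected cylinders have total measure `t`.

Part 2 is arithmetic: `G` consists of the integer multiples of `gcd (p a) / q` over `a ∈ α`, and the
overall gcd being `1` turns divisibility of all `l ^ R * p v` into divisibility of `l ^ R`. -/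

namespace StationaryBratteliDiagram

variable {V : Type u} {B : StationaryBratteliDiagram V}

/-! ### Topology of the path space and its cylinders. -/

section Finiteness

variable [Finite V]

instance : Finite B.TopEdge := inferInstanceAs (Finite (Σ v : V, Fin (B.hat v)))

instance : Finite B.Edge := inferInstanceAs (Finite (Σ w : V, Σ v : V, Fin (B.F v w)))

end Finiteness

namespace PathSpace

theorem src_edge (p : B.PathSpace) (n : ℕ) : (p.edge n).src = p.vertex n := by
  cases n with
  | zero => exact p.2.1
  | succ n => exact p.2.2 n

theorem rng_edge (p : B.PathSpace) (n : ℕ) : (p.edge n).rng = p.vertex (n + 1) := rfl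

theorem F_vertex_pos (p : B.PathSpace) (n : ℕ) : 0 < B.F (p.vertex (n + 1)) (p.vertex n) := by
  have h : 0 < B.F (p.edge n).rng (p.edge n).src := (Nat.zero_le _).trans_lt (p.edge n).2.2.2
  rwa [src_edge, rng_edge] at h

theorem mem_cylinder_self (p : B.PathSpace) (N : ℕ) : p ∈ p.cylinder N := ⟨rfl, fun _ _ => rfl⟩

theorem cylinder_eq_of_mem {p q : B.PathSpace} {N : ℕ} (h : q ∈ p.cylinder N) :
    q.cylinder N = p.cylinder N := by
  ext r
  constructor
  · exact fun hr => ⟨hr.1.trans h.1, fun n hn => (hr.2 n hn).trans (h.2 n hn)⟩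
  · exact fun hr => ⟨hr.1.trans h.1.symm, fun n hn => (hr.2 n hn).trans (h.2 n hn).symm⟩

theorem cylinder_anti (p : B.PathSpace) {M N : ℕ} (h : M ≤ N) : p.cylinder N ⊆ p.cylinder M :=
  fun _ hq => ⟨hq.1, fun n hn => hq.2 n (hn.trans_le h)⟩

theorem mem_cylinder_symm {p q : B.PathSpace} {N : ℕ} (h : q ∈ p.cylinder N) :
    p ∈ q.cylinder N := by
  rw [cylinder_eq_of_mem h]; exact mem_cylinder_self p N

theorem vertex_eq_of_mem_cylinder {p q : B.PathSpace} {N : ℕ} (h : q ∈ p.cylinder N) :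
    ∀ n ≤ N, q.vertex n = p.vertex n
  | 0, _ => congrArg Sigma.fst h.1
  | n + 1, hn => by rw [← rng_edge, ← rng_edge, h.2 n hn]

theorem continuous_top : Continuous (top : B.PathSpace → B.TopEdge) :=
  continuous_fst.comp continuous_subtype_val

theorem continuous_edge (n : ℕ) : Continuous (fun p : B.PathSpace => p.edge n) :=
  (continuous_apply n).comp (continuous_snd.comp continuous_subtype_val)

theorem isClopen_cylinder (p : B.PathSpace) (N : ℕ) : IsClopen (p.cylinder N) := by
  have : p.cylinder N = (top ⁻¹' {p.top}) ∩ ⋂ n ∈ Iio N, (fun q : B.PathSpace => q.edge n) ⁻¹'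
      {p.edge n} := by
    ext q; simp [cylinder]
  rw [this]
  exact ((isClopen_discrete _).preimage continuous_top).inter
    ((finite_Iio N).isClopen_biInter fun n _ =>
      (isClopen_discrete _).preimage (continuous_edge n))

theorem measurableSet_cylinder (p : B.PathSpace) (N : ℕ) : MeasurableSet (p.cylinder N) :=
  (isClopen_cylinder p N).isOpen.measurableSet

theorem exists_cylinder_subset {O : Set B.PathSpace} (hO : IsOpen O) {p : B.PathSpace}
    (hp : p ∈ O) : ∃ N, p.cylinder N ⊆ O := by
  obtain ⟨O', hO', rfl⟩ := isOpen_induced_iff.1 hO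
  obtain ⟨u, v, -, hv, hpu, hpv, huv⟩ := isOpen_prod_iff.1 hO' p.1.1 p.1.2 hp
  obtain ⟨I, w, hw, hI⟩ := isOpen_pi_iff.1 hv p.1.2 hpv
  refine ⟨I.sup id + 1, fun q hq => huv ⟨?_, hI fun n hn => ?_⟩⟩
  · have : q.1.1 = p.1.1 := hq.1
    rw [this]; exact hpu
  · have : q.1.2 n = p.1.2 n := hq.2 n (Nat.lt_succ_of_le (Finset.le_sup (f := id) hn))
    rw [this]; exact (hw n hn).2

/-- The compatibility conditions between consecutive edges are closed in a product of finite
discrete spaces. -/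
instance [Finite V] : CompactSpace B.PathSpace := by
  refine isCompact_iff_compactSpace.1 (IsClosed.isCompact ?_)
  refine IsClosed.inter ?_ ?_
  · exact (isClosed_discrete {z : B.Edge × B.TopEdge | z.1.src = z.2.1}).preimage
      (f := fun p : B.TopEdge × (ℕ → B.Edge) => (p.2 0, p.1)) (by fun_prop)
  · have h : {p : B.TopEdge × (ℕ → B.Edge) | ∀ n, (p.2 (n + 1)).src = (p.2 n).rng} =
        ⋂ n, (fun p : B.TopEdge × (ℕ → B.Edge) => (p.2 (n + 1), p.2 n)) ⁻¹'
          {z : B.Edge × B.Edge | z.1.src = z.2.rng} := by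
      ext; simp
    change IsClosed {p : B.TopEdge × (ℕ → B.Edge) | ∀ n, (p.2 (n + 1)).src = (p.2 n).rng}
    rw [h]
    exact isClosed_iInter fun n => (isClosed_discrete _).preimage (by fun_prop)

theorem isOpen_setOf_vertex (n : ℕ) (s : Set V) : IsOpen {p : B.PathSpace | p.vertex n ∈ s} := by
  cases n with
  | zero => exact (isOpen_discrete {e : B.TopEdge | e.1 ∈ s}).preimage continuous_top
  | succ n => exact (isOpen_discrete {e : B.Edge | e.rng ∈ s}).preimage (continuous_edge n)

theorem measurableSet_setOf_vertex (n : ℕ) (s : Set V) :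
    MeasurableSet {p : B.PathSpace | p.vertex n ∈ s} :=
  (isOpen_setOf_vertex n s).measurableSet

/-- An edge leaving a given vertex. -/
noncomputable def outEdge (B : StationaryBratteliDiagram V) (v : V) : B.Edge :=
  ⟨v, (B.exists_outgoing v).choose, ⟨0, (B.exists_outgoing v).choose_spec⟩⟩

/-- The path that follows `p` down to level `N + 1`, then the edge `e`, then default edges. -/
noncomputable def extend (p : B.PathSpace) (N : ℕ)
    (e : Σ w : V, Fin (B.F w (p.vertex N))) : B.PathSpace :=
  ⟨(p.top, fun n => if n < N then p.edge n else
      (fun f : B.Edge => outEdge B f.rng)^[n - N] ⟨p.vertex N, e⟩), by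
    constructor
    · by_cases h : 0 < N
      · simp only [h, if_true]
        exact src_edge p 0
      · obtain rfl : N = 0 := by omega
        rfl
    · intro n
      rcases lt_trichotomy (n + 1) N with h | h | h
      · simp only [h, if_true, (Nat.lt_succ_self n).trans h]
        exact src_edge p (n + 1)
      · subst h
        simp only [lt_irrefl, if_false, Nat.sub_self, Nat.lt_succ_self, if_true]
        rfl
      · have h1 : ¬ n + 1 < N := by omega
        have h2 : ¬ n < N := by omega
        have h3 : n + 1 - N = (n - N) + 1 := by omega
        simp only [h1, h2, if_false, h3]
        exact congrArg Edge.src (Function.iterate_succ_apply' _ _ _)⟩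

theorem extend_mem_cylinder (p : B.PathSpace) (N : ℕ) (e) : p.extend N e ∈ p.cylinder N :=
  ⟨rfl, fun _ hn => if_pos hn⟩

theorem extend_edge (p : B.PathSpace) (N : ℕ) (e) : (p.extend N e).edge N = ⟨p.vertex N, e⟩ := by
  exact (if_neg (lt_irrefl N)).trans (by rw [Nat.sub_self]; rfl)

theorem extend_vertex (p : B.PathSpace) (N : ℕ) (e) : (p.extend N e).vertex (N + 1) = e.1 := by
  rw [← rng_edge, extend_edge]; rfl

theorem mem_cylinder_extend_iff {p q : B.PathSpace} {N : ℕ} {e} :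
    q ∈ (p.extend N e).cylinder (N + 1) ↔ q ∈ p.cylinder N ∧ q.edge N = ⟨p.vertex N, e⟩ := by
  have h0 := extend_mem_cylinder p N e
  constructor
  · intro hq
    refine ⟨⟨hq.1.trans h0.1, fun n hn => (hq.2 n (by omega)).trans (h0.2 n hn)⟩, ?_⟩
    rw [hq.2 N (by omega), extend_edge]
  · rintro ⟨hq, hN⟩
    refine ⟨hq.1.trans h0.1.symm, fun n hn => ?_⟩
    rcases Nat.lt_succ_iff_lt_or_eq.1 hn with h | rfl
    · exact (hq.2 n h).trans (h0.2 n h).symm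
    · rw [hN, extend_edge]

theorem cylinder_eq_iUnion_extend (p : B.PathSpace) (N : ℕ) :
    p.cylinder N = ⋃ e, (p.extend N e).cylinder (N + 1) := by
  ext q
  simp only [mem_iUnion, mem_cylinder_extend_iff]
  constructor
  · intro hq
    have h : (q.edge N).1 = p.vertex N :=
      (src_edge q N).trans (vertex_eq_of_mem_cylinder hq N le_rfl)
    generalize q.edge N = f at h ⊢
    obtain ⟨w, e⟩ := f
    obtain rfl : w = p.vertex N := h
    exact ⟨e, hq, rfl⟩
  · rintro ⟨e, hq, -⟩
    exact hq

theorem disjoint_cylinder_extend (p : B.PathSpace) (N : ℕ) {e e'} (h : e ≠ e') :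
    Disjoint ((p.extend N e).cylinder (N + 1)) ((p.extend N e').cylinder (N + 1)) := by
  rw [Set.disjoint_left]
  intro q hq hq'
  rw [mem_cylinder_extend_iff] at hq hq'
  exact h (eq_of_heq (Sigma.mk.inj (hq.2.symm.trans hq'.2)).2)

theorem measure_cylinder_eq_sum [Fintype V] (ν : Measure B.PathSpace) (p : B.PathSpace) (N : ℕ) :
    ν (p.cylinder N) = ∑ e, ν ((p.extend N e).cylinder (N + 1)) := by
  rw [cylinder_eq_iUnion_extend, measure_iUnion (fun e e' h => disjoint_cylinder_extend p N h)
    (fun e => measurableSet_cylinder _ _), tsum_fintype]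

theorem exists_vertex_zero (v : V) : ∃ p : B.PathSpace, p.vertex 0 = v := by
  refine ⟨⟨(⟨v, ⟨0, B.hat_pos v⟩⟩, fun n => (fun f : B.Edge => outEdge B f.rng)^[n]
    (outEdge B v)), rfl, fun n => ?_⟩, rfl⟩
  simp only [Function.iterate_succ_apply']
  rfl

/-- Distinct members of `P` lie in different cylinders of level `N`. -/
def IsSeparated (P : Set B.PathSpace) (N : ℕ) : Prop :=
  ∀ p ∈ P, ∀ q ∈ P, q ∈ p.cylinder N → q = p

/-- Two paths in different cylinders of the same level span disjoint cylinders. -/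
theorem disjoint_cylinder {p q : B.PathSpace} {N : ℕ} (h : q ∉ p.cylinder N) :
    Disjoint (q.cylinder N) (p.cylinder N) := by
  rw [Set.disjoint_left]
  intro r hr hr'
  apply h
  rw [← cylinder_eq_of_mem hr']
  exact mem_cylinder_symm hr

theorem IsSeparated.measure_biUnion {P : Finset B.PathSpace} {N : ℕ}
    (hP : IsSeparated (P : Set B.PathSpace) N) (μ : Measure B.PathSpace) :
    μ (⋃ p ∈ P, p.cylinder N) = ∑ p ∈ P, μ (p.cylinder N) :=
  measure_biUnion_finset (fun p hp q hq hpq => disjoint_cylinder fun h =>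
    hpq (hP q hq p hp h)) fun p _ => measurableSet_cylinder p N

/-- Every set of paths has a finite set of representatives for its cylinders of level `N`. -/
theorem exists_representatives [Finite V] (S : Set B.PathSpace) (N : ℕ) :
    ∃ P : Finset B.PathSpace, (P : Set B.PathSpace) ⊆ S ∧
      IsSeparated (P : Set B.PathSpace) N ∧
      S ⊆ ⋃ p ∈ P, p.cylinder N := by
  let f : B.PathSpace → B.TopEdge × (Fin N → B.Edge) := fun p => (p.top, fun n => p.edge n)
  have hf : ∀ p q, f p = f q → p ∈ q.cylinder N := fun p q h =>
    ⟨(Prod.ext_iff.1 h).1, fun n hn => congrFun (Prod.ext_iff.1 h).2 ⟨n, hn⟩⟩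
  have hf' : ∀ p q, p ∈ q.cylinder N → f p = f q := fun p q h =>
    Prod.ext h.1 (funext fun n => h.2 n n.2)
  obtain ⟨S', hS', hb⟩ := S.exists_subset_bijOn f
  have hfin : S'.Finite := Set.Finite.of_finite_image (toFinite _) hb.injOn
  refine ⟨hfin.toFinset, by simpa using hS', ?_, ?_⟩
  · intro p hp q hq hpq
    exact hb.injOn (by simpa using hq) (by simpa using hp) (hf' _ _ hpq)
  · intro s hs
    obtain ⟨p, hp, hps⟩ := hb.surjOn (mem_image_of_mem f hs)
    simp only [mem_iUnion]
    exact ⟨p, by simpa using hp, hf _ _ hps.symm⟩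

end PathSpace

end StationaryBratteliDiagram

/-! ### Measures of cylinders and the support of `μ`. -/

namespace StationaryBratteliDiagram

open Filter Topology PathSpace

variable {V : Type u} {B : StationaryBratteliDiagram V} {α : Finset V}

theorem reaches_vertex (p : B.PathSpace) {m n : ℕ} (h : m ≤ n) :
    B.Reaches (p.vertex m) (p.vertex n) := by
  induction n, h using Nat.le_induction with
  | base => exact Relation.ReflTransGen.refl
  | succ n _ ih => exact ih.tail (F_vertex_pos p n)

/-- The paths all of whose vertices reach the class `α`. -/
def pathsReaching (B : StationaryBratteliDiagram V) (α : Finset V) : Set B.PathSpace :=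
  {p | ∀ n, ∃ a ∈ α, B.Reaches (p.vertex n) a}

theorem eventuallyIn_subset_pathsReaching : B.eventuallyIn α ⊆ B.pathsReaching α := by
  rintro p ⟨N, hN⟩ n
  exact ⟨_, hN (max n N) (le_max_right _ _), reaches_vertex p (le_max_left _ _)⟩

namespace IsVertexClass

variable (hα : B.IsVertexClass α)
include hα

theorem nonempty : α.Nonempty := by
  obtain ⟨a, ha⟩ := hα
  exact ⟨a, (ha a).2 ⟨Relation.ReflTransGen.refl, Relation.ReflTransGen.refl⟩⟩

theorem reaches {a b : V} (ha : a ∈ α) (hb : b ∈ α) : B.Reaches a b := by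
  obtain ⟨c, hc⟩ := hα
  exact ((hc a).1 ha).2.trans ((hc b).1 hb).1

theorem mem_of_reaches {a b v : V} (ha : a ∈ α) (hb : b ∈ α) (hav : B.Reaches a v)
    (hvb : B.Reaches v b) : v ∈ α := by
  obtain ⟨c, hc⟩ := hα
  exact (hc v).2 ⟨((hc a).1 ha).1.trans hav, hvb.trans ((hc b).1 hb).2⟩

/-- A path that can always return to `α` cannot leave it, so on `pathsReaching` the events "in `α`
at level `n`" increase with `n`. All the monotone limits below rest on this. -/
theorem vertex_mem {p : B.PathSpace} (hp : p ∈ B.pathsReaching α) {m n : ℕ} (hmn : m ≤ n)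
    (h : p.vertex m ∈ α) : p.vertex n ∈ α := by
  obtain ⟨a, ha, hna⟩ := hp n
  exact hα.mem_of_reaches h ha (reaches_vertex p hmn) hna

end IsVertexClass

open Classical in
/-- `entryMass B α lam x k v * lam⁻ᴺ` is the measure of the set of all paths that run through a
given cylinder of level `N` ending in `v` and are in `α` after `k` further steps. -/
noncomputable def entryMass [Fintype V] (B : StationaryBratteliDiagram V) (α : Finset V)
    (lam : ℝ) (x : V → ℝ) : ℕ → V → ℝ
  | 0, v => if v ∈ α then x v else 0
  | k + 1, v => (∑ w, B.A v w * entryMass B α lam x k w) / lam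

theorem A_apply (v w : V) : B.A v w = (B.F w v : ℝ) := rfl

theorem A_nonneg (v w : V) : 0 ≤ B.A v w := Nat.cast_nonneg _

section Measure

variable [Fintype V] {μ : Measure B.PathSpace} {lam : ℝ} {x : V → ℝ}

theorem mem_finiteVertices {v : V} : v ∈ B.finiteVertices μ α ↔ (∃ a ∈ α, B.Reaches v a) ∧
    ∀ (p : B.PathSpace) (N : ℕ), p.vertex N = v → μ (p.cylinder N) < ⊤ := by
  simp [finiteVertices]

theorem entryMass_eq_zero {v : V} (hv : ∀ a ∈ α, ¬ B.Reaches v a) (k : ℕ) :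
    entryMass B α lam x k v = 0 := by
  induction k generalizing v with
  | zero => exact if_neg fun h => hv v h Relation.ReflTransGen.refl
  | succ k ih =>
    rw [entryMass, Finset.sum_eq_zero, zero_div]
    intro w _
    rcases Nat.eq_zero_or_pos (B.F w v) with h | h
    · rw [A_apply, h]; simp
    · rw [ih fun a ha hwa => hv a ha (Relation.ReflTransGen.head h hwa), mul_zero]

namespace IsDefinedBy

variable (hdef : B.IsDefinedBy μ α lam x)
include hdef

theorem subset_finiteVertices : α ⊆ B.finiteVertices μ α := by
  intro a ha
  refine mem_finiteVertices.2 ⟨⟨a, ha, Relation.ReflTransGen.refl⟩, ?_⟩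
  rintro p N rfl
  rw [hdef.measure_cylinder p N ha]
  exact ENNReal.ofReal_lt_top

theorem pos_of_mem {a : V} (ha : a ∈ α) : 0 < x a := hdef.pos a (hdef.subset_finiteVertices ha)

theorem measure_compl_pathsReaching : μ (B.pathsReaching α)ᶜ = 0 :=
  measure_mono_null (compl_subset_compl.2 eventuallyIn_subset_pathsReaching) hdef.compl_null

/-- A nonzero measure leaves some path in `X_α`; one of its edges inside `α` makes the left side of
the eigenvector equation positive. -/
theorem lam_pos (hinf : μ univ = ⊤) : 0 < lam := by
  have hne : (B.eventuallyIn α).Nonempty := by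
    rw [nonempty_iff_ne_empty]
    intro h
    have := hdef.compl_null
    rw [h, compl_empty, hinf] at this
    exact ENNReal.top_ne_zero this
  obtain ⟨p, N, hN⟩ := hne
  have h0 := hN N le_rfl
  have h1 := hN (N + 1) (Nat.le_succ N)
  have hf0 := hdef.subset_finiteVertices h0
  have hf1 := hdef.subset_finiteVertices h1
  have hs : 0 < ∑ w ∈ B.finiteVertices μ α, B.A (p.vertex N) w * x w :=
    Finset.sum_pos' (fun w hw => mul_nonneg (A_nonneg _ _) (hdef.pos w hw).le)
      ⟨_, hf1, mul_pos (by rw [A_apply]; exact_mod_cast F_vertex_pos p N) (hdef.pos _ hf1)⟩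
  rw [hdef.eigen _ hf0] at hs
  exact pos_of_mul_pos_left hs (hdef.pos _ hf0).le

theorem entryMass_nonneg (hlam : 0 < lam) (k : ℕ) (v : V) : 0 ≤ entryMass B α lam x k v := by
  induction k generalizing v with
  | zero =>
    rw [entryMass]
    split_ifs with h
    · exact (hdef.pos_of_mem h).le
    · exact le_rfl
  | succ k ih =>
    exact div_nonneg (Finset.sum_nonneg fun w _ => mul_nonneg (A_nonneg _ _) (ih w)) hlam.le

/-- Split the cylinder by its next edge: the `F w v` edges towards `w` produce the factor `A v w` in
the recursion of `entryMass`. -/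
theorem measure_cylinder_inter (hlam : 0 < lam) (k : ℕ) (p : B.PathSpace) (N : ℕ) :
    μ (p.cylinder N ∩ {q | q.vertex (N + k) ∈ α}) =
      ENNReal.ofReal (entryMass B α lam x k (p.vertex N) / lam ^ N) := by
  induction k generalizing p N with
  | zero =>
    rw [entryMass]
    split_ifs with h
    · rw [inter_eq_left.2, hdef.measure_cylinder p N h]
      intro q hq
      simpa [vertex_eq_of_mem_cylinder hq N le_rfl] using h
    · rw [zero_div, ENNReal.ofReal_zero, ← measure_empty (μ := μ)]
      congr 1
      ext q
      simp only [mem_inter_iff, mem_ofPred_eq, mem_empty_iff_false, iff_false, not_and]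
      intro hq
      simpa [vertex_eq_of_mem_cylinder hq N le_rfl] using h
  | succ k ih =>
    have hm := measurableSet_setOf_vertex (B := B) (N + (k + 1)) (α : Set V)
    have h1 := measure_cylinder_eq_sum (μ.restrict {q | q.vertex (N + (k + 1)) ∈ α}) p N
    simp only [Measure.restrict_apply (measurableSet_cylinder _ _)] at h1
    rw [h1]
    have h2 : ∀ e, μ ((p.extend N e).cylinder (N + 1) ∩ {q | q.vertex (N + (k + 1)) ∈ α}) =
        ENNReal.ofReal (entryMass B α lam x k e.1 / lam ^ (N + 1)) := by
      intro e
      have := ih (p.extend N e) (N + 1)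
      rwa [extend_vertex, Nat.add_right_comm, Nat.add_assoc] at this
    have h3 : ∀ w, 0 ≤ entryMass B α lam x k w / lam ^ (N + 1) := fun w =>
      div_nonneg (hdef.entryMass_nonneg hlam k w) (by positivity)
    simp only [h2]
    rw [← ENNReal.ofReal_sum_of_nonneg (fun e _ => h3 e.1), Fintype.sum_sigma]
    congr 1
    simp only [Finset.sum_const, Finset.card_univ, Fintype.card_fin, nsmul_eq_mul]
    rw [entryMass, Finset.sum_div, Finset.sum_div]
    refine Finset.sum_congr rfl fun w _ => ?_
    rw [A_apply, pow_succ]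
    field_simp

theorem tendsto_measure_cylinder (hlam : 0 < lam) (p : B.PathSpace) (N : ℕ) :
    Tendsto (fun k => ENNReal.ofReal (entryMass B α lam x k (p.vertex N) / lam ^ N)) atTop
      (𝓝 (μ (p.cylinder N))) := by
  have hD := hdef.measure_compl_pathsReaching
  let s : ℕ → Set B.PathSpace := fun k =>
    (p.cylinder N ∩ {q | q.vertex (N + k) ∈ α}) ∩ B.pathsReaching α
  have hs : Monotone s := fun k l hkl q hq =>
    ⟨⟨hq.1.1, hdef.isVertexClass.vertex_mem hq.2 (Nat.add_le_add_left hkl N) hq.1.2⟩, hq.2⟩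
  have hsμ : ∀ k, μ (s k) = ENNReal.ofReal (entryMass B α lam x k (p.vertex N) / lam ^ N) := by
    intro k
    rw [← hdef.measure_cylinder_inter hlam k p N]
    exact measure_inter_conull hD
  have hU : μ (⋃ k, s k) = μ (p.cylinder N) := by
    refine le_antisymm (measure_mono (iUnion_subset fun k q hq => hq.1.1)) ?_
    rw [← measure_inter_conull (s := p.cylinder N) hdef.compl_null]
    refine measure_mono ?_
    rintro q ⟨hq, hqα⟩
    have hqD := eventuallyIn_subset_pathsReaching hqα
    obtain ⟨M, hM⟩ := hqα
    exact mem_iUnion.2 ⟨M, ⟨hq, hM _ (Nat.le_add_left _ _)⟩, hqD⟩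
  rw [← hU]
  simp only [← hsμ]
  exact tendsto_measure_iUnion_atTop hs

/-- Entry masses depend only on the end vertex, so cylinders ending in the same vertex have measures
differing by a power of `lam`. -/
theorem measure_cylinder_lt_top (hlam : 0 < lam) {p q : B.PathSpace} {M N : ℕ}
    (h : p.vertex M = q.vertex N) (hp : μ (p.cylinder M) < ⊤) : μ (q.cylinder N) < ⊤ := by
  have h1 := ENNReal.Tendsto.mul_const (b := ENNReal.ofReal (lam ^ M / lam ^ N))
    (hdef.tendsto_measure_cylinder hlam p M) (Or.inr ENNReal.ofReal_ne_top)
  have h2 := hdef.tendsto_measure_cylinder hlam q N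
  rw [← h] at h2
  have h3 : ∀ k, ENNReal.ofReal (entryMass B α lam x k (p.vertex M) / lam ^ M) *
      ENNReal.ofReal (lam ^ M / lam ^ N) =
      ENNReal.ofReal (entryMass B α lam x k (p.vertex M) / lam ^ N) := by
    intro k
    rw [← ENNReal.ofReal_mul (div_nonneg (hdef.entryMass_nonneg hlam k _) (by positivity))]
    congr 1
    field_simp
  simp only [h3] at h1
  rw [tendsto_nhds_unique h2 h1]
  exact ENNReal.mul_lt_top hp ENNReal.ofReal_lt_top

theorem mem_finiteVertices_of_lt_top (hlam : 0 < lam) {p : B.PathSpace} {N : ℕ}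
    (hr : ∃ a ∈ α, B.Reaches (p.vertex N) a) (hp : μ (p.cylinder N) < ⊤) :
    p.vertex N ∈ B.finiteVertices μ α :=
  mem_finiteVertices.2 ⟨hr, fun _ _ h => hdef.measure_cylinder_lt_top hlam h.symm hp⟩

theorem measure_cylinder_pos (hlam : 0 < lam) {v a : V} (ha : a ∈ α) (h : B.Reaches v a)
    (p : B.PathSpace) (N : ℕ) (hv : p.vertex N = v) : 0 < μ (p.cylinder N) := by
  induction h using Relation.ReflTransGen.head_induction_on generalizing p N with
  | refl =>
    rw [hdef.measure_cylinder p N (hv ▸ ha), ENNReal.ofReal_pos]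
    exact div_pos (hdef.pos_of_mem (hv ▸ ha)) (by positivity)
  | head hvw _ ih =>
    subst hv
    refine (ih (p.extend N ⟨_, ⟨0, hvw⟩⟩) (N + 1) (extend_vertex p N _)).trans_le
      (measure_mono ?_)
    rw [cylinder_eq_iUnion_extend p N]
    exact subset_iUnion (fun e => (p.extend N e).cylinder (N + 1)) _

theorem mem_finiteVertices_of_edge (hlam : 0 < lam) {v w : V} (hv : v ∈ B.finiteVertices μ α)
    (hvw : 0 < B.F w v) (hw : ∃ a ∈ α, B.Reaches w a) : w ∈ B.finiteVertices μ α := by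
  obtain ⟨p, rfl⟩ := exists_vertex_zero (B := B) v
  have h1 := (mem_finiteVertices.1 hv).2 p 0 rfl
  have h2 := extend_vertex p 0 ⟨w, ⟨0, hvw⟩⟩
  have h3 := hdef.mem_finiteVertices_of_lt_top hlam (p := p.extend 0 ⟨w, ⟨0, hvw⟩⟩)
    (N := 0 + 1) (by rwa [h2]) ?_
  · rwa [h2] at h3
  · refine (measure_mono ?_).trans_lt h1
    rw [cylinder_eq_iUnion_extend p 0]
    exact subset_iUnion (fun e => (p.extend 0 e).cylinder (0 + 1)) _

/-- A successor of a vertex of `V_f` that lies outside `V_f` cannot reach `α`, so its entry mass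
vanishes and the recursion closes on `V_f`. -/
theorem entryMass_succ (hlam : 0 < lam) {v : V} (hv : v ∈ B.finiteVertices μ α) (k : ℕ) :
    entryMass B α lam x (k + 1) v =
      (∑ w ∈ B.finiteVertices μ α, B.A v w * entryMass B α lam x k w) / lam := by
  rw [entryMass]
  congr 1
  refine (Finset.sum_subset (Finset.subset_univ _) fun w _ hw => ?_).symm
  rcases Nat.eq_zero_or_pos (B.F w v) with h | h
  · rw [A_apply, h]; simp
  · rw [entryMass_eq_zero, mul_zero]
    intro a ha hwa
    exact hw (hdef.mem_finiteVertices_of_edge hlam hv h ⟨a, ha, hwa⟩)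

/-- On the vertices of `B_f` the eigenvector `x` is the limit of the entry masses. -/
theorem tendsto_entryMass (hlam : 0 < lam) {v : V} (hv : v ∈ B.finiteVertices μ α) :
    Tendsto (fun k => entryMass B α lam x k v) atTop (𝓝 (x v)) := by
  classical
  set I := B.finiteVertices μ α with hI
  have hex : ∀ w ∈ I, ∃ r, 0 < r ∧ Tendsto (fun k => entryMass B α lam x k w) atTop (𝓝 r) := by
    intro w hw
    obtain ⟨p, rfl⟩ := exists_vertex_zero (B := B) w
    obtain ⟨⟨a, ha, hwa⟩, hfin⟩ := mem_finiteVertices.1 hw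
    have hlt := hfin p 0 rfl
    refine ⟨(μ (p.cylinder 0)).toReal,
      ENNReal.toReal_pos (hdef.measure_cylinder_pos hlam ha hwa p 0 rfl).ne' hlt.ne, ?_⟩
    have := (ENNReal.tendsto_toReal hlt.ne).comp (hdef.tendsto_measure_cylinder hlam p 0)
    refine this.congr fun k => ?_
    simp [ENNReal.toReal_ofReal (hdef.entryMass_nonneg hlam k _)]
  choose! r hr0 hr using hex
  -- The limit `r` is an eigenvector for `lam`, just like `x`. What remains is a uniqueness
  -- argument: both agree on `α`, and `r ≤ x`.
  have hreig : ∀ w ∈ I, r w = (∑ u ∈ I, B.A w u * r u) / lam := by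
    intro w hw
    refine tendsto_nhds_unique ((tendsto_add_atTop_iff_nat 1).2 (hr w hw)) ?_
    simp only [hdef.entryMass_succ hlam hw]
    exact (tendsto_finsetSum _ fun u hu => (hr u hu).const_mul _).div_const _
  have hxeig : ∀ w ∈ I, x w = (∑ u ∈ I, B.A w u * x u) / lam := by
    intro w hw
    rw [hdef.eigen w hw]; field_simp
  have hle : ∀ k, ∀ w ∈ I, entryMass B α lam x k w ≤ x w := by
    intro k
    induction k with
    | zero =>
      intro w hw
      rw [entryMass]
      split_ifs
      · exact le_rfl
      · exact (hdef.pos w hw).le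
    | succ k ih =>
      intro w hw
      rw [hdef.entryMass_succ hlam hw, hxeig w hw]
      gcongr with u hu
      · exact A_nonneg _ _
      · exact ih u hu
  have hrx : ∀ w ∈ I, r w ≤ x w := fun w hw => le_of_tendsto' (hr w hw) fun k => hle k w hw
  have hα : ∀ w ∈ α, r w = x w := by
    intro w hw
    refine le_antisymm (hrx w (hdef.subset_finiteVertices hw)) ?_
    obtain ⟨p, rfl⟩ := exists_vertex_zero (B := B) w
    have h1 := hdef.tendsto_measure_cylinder hlam p 0
    rw [hdef.measure_cylinder p 0 hw] at h1
    have h2 := (ENNReal.tendsto_toReal ENNReal.ofReal_ne_top).comp h1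
    have h3 := tendsto_nhds_unique (h2.congr fun k => by
      simp [ENNReal.toReal_ofReal (hdef.entryMass_nonneg hlam k _)])
      (hr _ (hdef.subset_finiteVertices hw))
    rw [← h3, ENNReal.toReal_ofReal (by simpa using (hdef.pos_of_mem hw).le)]
    simp
  obtain ⟨c, hc⟩ : ∃ c : ℝ, ∀ w ∈ I, x w - r w ≤ c * r w := by
    refine ⟨∑ u ∈ I, (x u - r u) / r u, fun w hw => ?_⟩
    rw [← div_le_iff₀ (hr0 w hw)]
    exact Finset.single_le_sum (f := fun u => (x u - r u) / r u)
      (fun u hu => div_nonneg (sub_nonneg.2 (hrx u hu)) (hr0 u hu).le) hw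
  -- At `k = 0` both sides vanish on `α`, and off `α` this is the choice of `c`. The three vectors
  -- obey the same nonnegative linear recursion, so the bound propagates; its right side tends to
  -- `0`.
  have hdom : ∀ k, ∀ w ∈ I, x w - r w ≤ c * (r w - entryMass B α lam x k w) := by
    intro k
    induction k with
    | zero =>
      intro w hw
      rw [entryMass]
      split_ifs with h
      · rw [hα w h]; simp
      · simpa using hc w hw
    | succ k ih =>
      intro w hw
      rw [hdef.entryMass_succ hlam hw, hxeig w hw, hreig w hw, ← sub_div, ← sub_div,
        ← mul_div_assoc, ← Finset.sum_sub_distrib, ← Finset.sum_sub_distrib, Finset.mul_sum]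
      gcongr with u hu
      nlinarith [mul_le_mul_of_nonneg_left (ih u hu) (A_nonneg (B := B) w u)]
  have hlim : x v - r v ≤ c * (r v - r v) :=
    ge_of_tendsto' ((tendsto_const_nhds.sub (hr v hv)).const_mul c) fun k => hdom k v hv
  have : x v = r v := le_antisymm (by linarith) (hrx v hv)
  rw [this]
  exact hr v hv

theorem measure_cylinder_eq (hlam : 0 < lam) (p : B.PathSpace) (N : ℕ)
    (hv : p.vertex N ∈ B.finiteVertices μ α) :
    μ (p.cylinder N) = ENNReal.ofReal (x (p.vertex N) / lam ^ N) :=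
  tendsto_nhds_unique (hdef.tendsto_measure_cylinder hlam p N)
    (ENNReal.tendsto_ofReal ((hdef.tendsto_entryMass hlam hv).div_const _))

/-- Cylinders ending in a vertex that reaches `α` have positive measure; the others miss `X_α` and
are null. -/
theorem support_eq (hlam : 0 < lam) : μ.support = B.pathsReaching α := by
  ext p
  constructor
  · intro hp n
    by_contra hcon
    have h0 : μ (p.cylinder n) = 0 := by
      refine measure_mono_null (t := (B.eventuallyIn α)ᶜ) (fun q hq hqα => hcon ?_) hdef.compl_null
      have := eventuallyIn_subset_pathsReaching hqα n
      rwa [vertex_eq_of_mem_cylinder hq n le_rfl] at this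
    exact ((Measure.mem_support_iff_forall p).1 hp _
      ((isClopen_cylinder p n).isOpen.mem_nhds (mem_cylinder_self p n))).ne' h0
  · intro hp
    refine (Measure.mem_support_iff_forall p).2 fun U hU => ?_
    obtain ⟨O, hOU, hO, hpO⟩ := mem_nhds_iff.1 hU
    obtain ⟨N, hN⟩ := exists_cylinder_subset hO hpO
    obtain ⟨a, ha, hra⟩ := hp N
    exact (hdef.measure_cylinder_pos hlam ha hra p N rfl).trans_le
      (measure_mono (hN.trans hOU))

end IsDefinedBy

end Measure

end StationaryBratteliDiagram

/-! ### Positive stochastic matrices, walk counts and primitivity. -/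

/-- Products of a positive row-stochastic matrix with a positive vector flatten out: for every
`y` with positive sum, the pairings with `y` are eventually positive. -/
theorem eventually_sum_mul_pos_of_stochastic {ι : Type*} [Fintype ι] [Nonempty ι]
    {P : ι → ι → ℝ} (hP : ∀ a c, 0 < P a c) (hsum : ∀ a, ∑ c, P a c = 1) {g : ℕ → ι → ℝ}
    (h0 : ∀ a, 0 < g 0 a) (hg : ∀ j a, g (j + 1) a = ∑ c, P a c * g j c) {y : ι → ℝ}
    (hy : 0 < ∑ a, y a) : ∀ᶠ j in Filter.atTop, 0 < ∑ a, y a * g j a := by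
  classical
  obtain ⟨ac, hac⟩ := Finite.exists_min (fun ac : ι × ι => P ac.1 ac.2)
  set ε := P ac.1 ac.2 with hε
  have hε0 : 0 < ε := hP _ _
  have hεP : ∀ a c, ε ≤ P a c := fun a c => hac (a, c)
  have hε1 : ε ≤ 1 := by
    rw [← hsum ac.1]
    exact Finset.single_le_sum (f := fun c => P ac.1 c) (fun c _ => (hP _ c).le)
      (Finset.mem_univ ac.2)
  obtain ⟨a₀, ha₀⟩ := Finite.exists_min (g 0)
  obtain ⟨a₁, ha₁⟩ := Finite.exists_max (g 0)
  -- The oscillation shrinks by the factor `1 - ε` at each step, while the lower bound never drops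
  -- below the initial minimum.
  have key : ∀ j, ∃ lo hi, g 0 a₀ ≤ lo ∧ (∀ a, lo ≤ g j a ∧ g j a ≤ hi) ∧
      hi - lo ≤ (1 - ε) ^ j * (g 0 a₁ - g 0 a₀) := by
    intro j
    induction j with
    | zero => exact ⟨g 0 a₀, g 0 a₁, le_rfl, fun a => ⟨ha₀ a, ha₁ a⟩, by simp⟩
    | succ j ih =>
      obtain ⟨lo, hi, h1, h2, h3⟩ := ih
      -- Any fixed index would do: each new entry gives weight at least `ε` to `g j c`, which moves
      -- both bounds towards that value.
      let c := ac.2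
      refine ⟨lo + ε * (g j c - lo), hi - ε * (hi - g j c), ?_, fun a => ⟨?_, ?_⟩, ?_⟩
      · have := mul_nonneg hε0.le (sub_nonneg.2 (h2 c).1); linarith
      · have hA : g (j + 1) a - lo = ∑ d, P a d * (g j d - lo) := by
          simp only [mul_sub, Finset.sum_sub_distrib, ← Finset.sum_mul, hsum, hg]; ring
        have hB : P a c * (g j c - lo) ≤ ∑ d, P a d * (g j d - lo) :=
          Finset.single_le_sum (f := fun d => P a d * (g j d - lo))
            (fun d _ => mul_nonneg (hP _ _).le (sub_nonneg.2 (h2 d).1)) (Finset.mem_univ c)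
        have := mul_le_mul_of_nonneg_right (hεP a c) (sub_nonneg.2 (h2 c).1)
        linarith
      · have hA : hi - g (j + 1) a = ∑ d, P a d * (hi - g j d) := by
          simp only [mul_sub, Finset.sum_sub_distrib, ← Finset.sum_mul, hsum, hg]; ring
        have hB : P a c * (hi - g j c) ≤ ∑ d, P a d * (hi - g j d) :=
          Finset.single_le_sum (f := fun d => P a d * (hi - g j d))
            (fun d _ => mul_nonneg (hP _ _).le (sub_nonneg.2 (h2 d).2)) (Finset.mem_univ c)
        have := mul_le_mul_of_nonneg_right (hεP a c) (sub_nonneg.2 (h2 c).2)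
        linarith
      · have := mul_le_mul_of_nonneg_left h3 (sub_nonneg.2 hε1)
        rw [pow_succ]
        linarith
  set Z := ∑ a, |y a| with hZ
  have hlim : Filter.Tendsto (fun j => Z * ((1 - ε) ^ j * (g 0 a₁ - g 0 a₀))) Filter.atTop
      (nhds (Z * (0 * (g 0 a₁ - g 0 a₀)))) :=
    ((tendsto_pow_atTop_nhds_zero_of_lt_one (by linarith) (by linarith)).mul_const _).const_mul _
  have hpos : Z * (0 * (g 0 a₁ - g 0 a₀)) < (∑ a, y a) * g 0 a₀ := by
    simpa using mul_pos hy (h0 a₀)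
  filter_upwards [hlim.eventually_lt_const hpos] with j hj
  obtain ⟨lo, hi, h1, h2, h3⟩ := key j
  have hA : ∑ a, y a * g j a = (∑ a, y a) * lo + ∑ a, y a * (g j a - lo) := by
    rw [Finset.sum_mul, ← Finset.sum_add_distrib]
    exact Finset.sum_congr rfl fun a _ => by ring
  have hB : -(Z * (hi - lo)) ≤ ∑ a, y a * (g j a - lo) := by
    rw [hZ, Finset.sum_mul, ← Finset.sum_neg_distrib]
    refine Finset.sum_le_sum fun a _ => ?_
    have e1 := mul_le_mul_of_nonneg_right (neg_abs_le (y a)) (sub_nonneg.2 (h2 a).1)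
    have e2 := mul_le_mul_of_nonneg_left (sub_le_sub_right (h2 a).2 lo) (abs_nonneg (y a))
    linarith
  have hC := mul_le_mul_of_nonneg_left h3 (Finset.sum_nonneg fun a _ => abs_nonneg (y a) : 0 ≤ Z)
  have hD := mul_le_mul_of_nonneg_left h1 hy.le
  linarith

namespace StationaryBratteliDiagram

open Filter Topology PathSpace

variable {V : Type u} {B : StationaryBratteliDiagram V} {α : Finset V}

open Classical in
/-- The number of downward paths of length `k` from the vertex `v` to the vertex `w`. -/
noncomputable def walks [Fintype V] (B : StationaryBratteliDiagram V) : ℕ → V → V → ℕ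
  | 0, v, w => if v = w then 1 else 0
  | k + 1, v, w => ∑ u, B.F u v * walks B k u w

section Walks

variable [Fintype V]

theorem walks_add (k l : ℕ) (v w : V) :
    B.walks (k + l) v w = ∑ u, B.walks k v u * B.walks l u w := by
  induction k generalizing v with
  | zero => classical simp [walks]
  | succ k ih =>
    rw [Nat.add_right_comm, walks]
    simp only [ih, walks, Finset.sum_mul, Finset.mul_sum, ← mul_assoc]
    exact Finset.sum_comm

theorem walks_add_pos {k l : ℕ} {u v w : V} (h : 0 < B.walks k u v) (h' : 0 < B.walks l v w) :
    0 < B.walks (k + l) u w := by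
  rw [walks_add]
  exact (Nat.mul_pos h h').trans_le (Finset.single_le_sum
    (f := fun v => B.walks k u v * B.walks l v w) (fun _ _ => Nat.zero_le _) (Finset.mem_univ v))

theorem walks_one (v w : V) : B.walks 1 v w = B.F w v := by
  classical simp [walks]

theorem reaches_of_walks_pos {k : ℕ} {v w : V} (h : 0 < B.walks k v w) : B.Reaches v w := by
  induction k generalizing v with
  | zero =>
    rw [walks] at h
    split_ifs at h with hvw
    · exact hvw ▸ Relation.ReflTransGen.refl
    · exact absurd h (lt_irrefl 0)
  | succ k ih =>
    rw [walks] at h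
    obtain ⟨u, -, hu⟩ := Finset.exists_ne_zero_of_sum_ne_zero h.ne'
    exact Relation.ReflTransGen.head (Nat.pos_of_ne_zero (left_ne_zero_of_mul hu))
      (ih (Nat.pos_of_ne_zero (right_ne_zero_of_mul hu)))

theorem exists_walks_pos {v w : V} (h : B.Reaches v w) : ∃ k, 0 < B.walks k v w := by
  induction h with
  | refl => exact ⟨0, by simp [walks]⟩
  | tail _ hvw ih =>
    obtain ⟨k, hk⟩ := ih
    exact ⟨k + 1, walks_add_pos hk (by rwa [walks_one])⟩

theorem IsVertexClass.walks_add (hα : B.IsVertexClass α) (k l : ℕ) {a b : V} (ha : a ∈ α)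
    (hb : b ∈ α) : B.walks (k + l) a b = ∑ c ∈ α, B.walks k a c * B.walks l c b := by
  rw [StationaryBratteliDiagram.walks_add]
  refine (Finset.sum_subset (Finset.subset_univ _) fun c _ hc => ?_).symm
  by_contra h
  exact hc (hα.mem_of_reaches ha hb
    (reaches_of_walks_pos (Nat.pos_of_ne_zero (left_ne_zero_of_mul h)))
    (reaches_of_walks_pos (Nat.pos_of_ne_zero (right_ne_zero_of_mul h))))

variable {μ : Measure B.PathSpace} {lam : ℝ} {x : V → ℝ}

namespace IsDefinedBy

variable (hdef : B.IsDefinedBy μ α lam x)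
include hdef

/-- A successor of a vertex of `α` that lies in `V_f` reaches `α` again, hence belongs to `α`. -/
theorem sum_F_mul {a : V} (ha : a ∈ α) : ∑ w ∈ α, (B.F w a : ℝ) * x w = lam * x a := by
  rw [← hdef.eigen a (hdef.subset_finiteVertices ha)]
  refine Finset.sum_subset hdef.subset_finiteVertices fun w hw hwα => ?_
  rcases Nat.eq_zero_or_pos (B.F w a) with h | h
  · rw [h]; simp
  · obtain ⟨b, hb, hwb⟩ := (mem_finiteVertices.1 hw).1
    exact absurd (hdef.isVertexClass.mem_of_reaches ha hb (Relation.ReflTransGen.single h) hwb) hwα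

theorem sum_walks_mul (k : ℕ) {a : V} (ha : a ∈ α) :
    ∑ b ∈ α, (B.walks k a b : ℝ) * x b = lam ^ k * x a := by
  induction k generalizing a with
  | zero => classical simp [walks, ha]
  | succ k ih =>
    have h : ∀ b ∈ α, (B.walks (k + 1) a b : ℝ) * x b =
        ∑ c ∈ α, (B.F c a : ℝ) * (B.walks k c b * x b) := by
      intro b hb
      rw [Nat.add_comm, hdef.isVertexClass.walks_add 1 k ha hb, Nat.cast_sum, Finset.sum_mul]
      exact Finset.sum_congr rfl fun c _ => by rw [walks_one]; push_cast; ring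
    rw [Finset.sum_congr rfl h, Finset.sum_comm]
    simp only [← Finset.mul_sum]
    rw [Finset.sum_congr rfl fun c hc => by rw [ih hc, mul_left_comm], ← Finset.mul_sum,
      hdef.sum_F_mul ha, pow_succ]
    ring

theorem exists_walks_pos_mem (hlam : 0 < lam) (k : ℕ) {a : V} (ha : a ∈ α) :
    ∃ b ∈ α, 0 < B.walks k a b := by
  have h : ∑ b ∈ α, (B.walks k a b : ℝ) * x b ≠ 0 := by
    rw [hdef.sum_walks_mul k ha]
    exact (mul_pos (pow_pos hlam k) (hdef.pos_of_mem ha)).ne'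
  obtain ⟨b, hb, hne⟩ := Finset.exists_ne_zero_of_sum_ne_zero h
  exact ⟨b, hb, Nat.pos_of_ne_zero (by exact_mod_cast left_ne_zero_of_mul hne)⟩

/-- Ergodicity: almost every path meets some path that starts in the class vertex `a`. -/
theorem ae_exists_walks_pos (herg : B.IsTailErgodic μ) {a : V} (ha : a ∈ α) :
    ∀ᵐ q ∂μ, ∃ n, 0 < B.walks n a (q.vertex n) := by
  have hopen : IsOpen {q : B.PathSpace | ∃ n, 0 < B.walks n a (q.vertex n)} := by
    have : {q : B.PathSpace | ∃ n, 0 < B.walks n a (q.vertex n)} =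
        ⋃ n, {q | q.vertex n ∈ {v | 0 < B.walks n a v}} := by
      ext; simp
    rw [this]
    exact isOpen_iUnion fun n => isOpen_setOf_vertex n _
  refine (herg _ hopen.measurableSet ?_).resolve_left ?_
  · rintro p q ⟨N, hN⟩ ⟨n, hn⟩
    have hstep : ∀ m, n ≤ m → 0 < B.walks m a (p.vertex m) := by
      intro m hm
      induction m, hm using Nat.le_induction with
      | base => exact hn
      | succ m _ ih => exact walks_add_pos ih (by rw [walks_one]; exact F_vertex_pos p m)
    refine ⟨max n N + 1, ?_⟩
    rw [← rng_edge, ← hN _ (le_max_right _ _), rng_edge]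
    exact hstep _ ((le_max_left _ _).trans (Nat.le_succ _))
  · intro h0
    obtain ⟨p, rfl⟩ := exists_vertex_zero (B := B) a
    have h1 : μ (p.cylinder 0) = 0 := by
      refine measure_mono_null (fun q hq => (⟨0, ?_⟩ : ∃ n, 0 < B.walks n _ (q.vertex n))) h0
      rw [vertex_eq_of_mem_cylinder hq 0 le_rfl]
      simp [walks]
    rw [hdef.measure_cylinder p 0 ha, ENNReal.ofReal_eq_zero] at h1
    have := hdef.pos_of_mem ha
    simp only [pow_zero, div_one] at h1
    linarith

/-- The restriction of the incidence matrix to `α` is primitive. -/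
theorem exists_walks_pos_of_le (herg : B.IsTailErgodic μ) (hinf : μ univ = ⊤) :
    ∃ K, ∀ k ≥ K, ∀ a ∈ α, ∀ b ∈ α, 0 < B.walks k a b := by
  have hlam := hdef.lam_pos hinf
  have hae : ∀ᵐ q ∂μ, q ∈ B.eventuallyIn α ∧ ∀ a ∈ α, ∃ n, 0 < B.walks n a (q.vertex n) := by
    have h1 : ∀ᵐ q ∂μ, q ∈ B.eventuallyIn α := hdef.compl_null
    have h2 : ∀ᵐ q ∂μ, ∀ a ∈ α, ∃ n, 0 < B.walks n a (q.vertex n) :=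
      (Finset.eventually_all α).2 fun a ha => hdef.ae_exists_walks_pos herg ha
    exact h1.and h2
  have hμ : μ ≠ 0 := by
    rintro rfl
    simp at hinf
  have : (ae μ).NeBot := ae_neBot.2 hμ
  obtain ⟨q, ⟨N, hN⟩, hq⟩ := hae.exists
  choose! n hn using hq
  have hstep : ∀ a ∈ α, ∀ m, n a ≤ m → 0 < B.walks m a (q.vertex m) := by
    intro a ha m hm
    induction m, hm using Nat.le_induction with
    | base => exact hn a ha
    | succ m _ ih => exact walks_add_pos ih (by rw [walks_one]; exact F_vertex_pos q m)
  -- By level `M` walks from all of `α` have merged with `q`, so they reach one vertex of `α` in the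
  -- same number of steps. This excludes periodicity.
  set M := max N (α.sup n) with hM
  have hc : q.vertex M ∈ α := hN M (le_max_left _ _)
  have hcM : ∀ a ∈ α, 0 < B.walks M a (q.vertex M) := fun a ha =>
    hstep a ha M ((Finset.le_sup ha).trans (le_max_right _ _))
  have hcm : ∀ m ≥ M, ∀ a ∈ α, 0 < B.walks m a (q.vertex M) := by
    intro m hm a ha
    obtain ⟨b, hb, hab⟩ := hdef.exists_walks_pos_mem hlam (m - M) ha
    have := walks_add_pos hab (hcM b hb)
    rwa [Nat.sub_add_cancel hm] at this
  have hl : ∀ b ∈ α, ∃ l, 0 < B.walks l (q.vertex M) b := fun b hb =>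
    exists_walks_pos (hdef.isVertexClass.reaches hc hb)
  choose! l hl using hl
  refine ⟨M + α.sup l, fun k hk a ha b hb => ?_⟩
  have hlb : l b ≤ α.sup l := Finset.le_sup hb
  have := walks_add_pos (hcm (k - l b) (by omega) a ha) (hl b hb)
  rwa [Nat.sub_add_cancel (by omega)] at this

theorem eventually_sum_mul_walks_pos (herg : B.IsTailErgodic μ) (hinf : μ univ = ⊤) :
    ∃ K, ∀ z : V → ℝ, 0 < ∑ a ∈ α, z a * x a → ∀ b ∈ α,
      ∀ᶠ j in atTop, 0 < ∑ a ∈ α, z a * B.walks (K * j + K) a b := by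
  have hlam := hdef.lam_pos hinf
  obtain ⟨K, hK⟩ := hdef.exists_walks_pos_of_le herg hinf
  refine ⟨K, fun z hz b hb => ?_⟩
  have hx : ∀ a : α, x a ≠ 0 := fun a => (hdef.pos_of_mem a.2).ne'
  have : Nonempty α := hdef.isVertexClass.nonempty.to_subtype
  -- The `K`-step walk matrix, conjugated by the eigenvector and divided by `lam ^ K`, is stochastic
  -- and positive. The extra `K` steps in `g` make `g 0` positive.
  have h := eventually_sum_mul_pos_of_stochastic (ι := α)
    (P := fun a c => B.walks K a c * x c / (lam ^ K * x a))
    (g := fun j a => B.walks (K * j + K) a b / (lam ^ (K * j) * x a))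
    (y := fun a => z a * x a) ?_ ?_ ?_ ?_ ?_
  · filter_upwards [h] with j hj
    have he : ∀ a : α, z a * x a * (B.walks (K * j + K) a b / (lam ^ (K * j) * x a)) =
        (z a * B.walks (K * j + K) a b) / lam ^ (K * j) := fun a => by
      have := hx a
      field_simp
    simp only [he, ← Finset.sum_div] at hj
    rw [← Finset.sum_coe_sort]
    exact (div_pos_iff_of_pos_right (pow_pos hlam _)).1 hj
  · intro a c
    have h1 := hK K le_rfl a a.2 c c.2
    have h2 := hdef.pos_of_mem a.2
    have h3 := hdef.pos_of_mem c.2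
    positivity
  · intro a
    rw [← Finset.sum_div, Finset.sum_coe_sort α (fun c => (B.walks K a c : ℝ) * x c),
      hdef.sum_walks_mul K a.2]
    exact div_self (mul_ne_zero (pow_pos hlam K).ne' (hx a))
  · intro a
    have h1 := hK K le_rfl a a.2 b hb
    have h2 := hdef.pos_of_mem a.2
    simp only [mul_zero, zero_add, pow_zero, one_mul]
    positivity
  · intro j a
    have e : K * (j + 1) + K = K + (K * j + K) := by ring
    rw [e, hdef.isVertexClass.walks_add K _ a.2 hb, Nat.cast_sum, Finset.sum_div,
      ← Finset.sum_coe_sort]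
    refine Finset.sum_congr rfl fun c _ => ?_
    have := hx a
    have := hx c
    rw [show K * (j + 1) = K + K * j by ring, pow_add]
    push_cast
    field_simp
  · rwa [Finset.sum_coe_sort α (fun a => z a * x a)]

end IsDefinedBy

end Walks

end StationaryBratteliDiagram

/-! ### Clopen subsets of the support as unions of cylinder traces. -/

namespace StationaryBratteliDiagram

open Filter Topology PathSpace

variable {V : Type u} {B : StationaryBratteliDiagram V} {α : Finset V}

/-- `S` is the trace on `T` of a union of cylinders of level `N`. -/
def IsLevelSet (T : Set B.PathSpace) (N : ℕ) (S : Set B.PathSpace) : Prop :=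
  S ⊆ T ∧ ∀ p ∈ S, ∀ q ∈ T, q ∈ p.cylinder N → q ∈ S

namespace IsLevelSet

variable {T S : Set B.PathSpace} {M N : ℕ}

theorem mono (h : IsLevelSet T M S) (hMN : M ≤ N) : IsLevelSet T N S :=
  ⟨h.1, fun p hp q hq hqp => h.2 p hp q hq (cylinder_anti p hMN hqp)⟩

theorem diff (h : IsLevelSet T N S) : IsLevelSet T N (T \ S) :=
  ⟨sdiff_subset, fun p hp q hq hqp => ⟨hq, fun hqS => hp.2 (h.2 q hqS p hp.1
    (mem_cylinder_symm hqp))⟩⟩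

theorem inter_vertex (h : IsLevelSet T N S) (s : Set V) :
    IsLevelSet T N (S ∩ {p | p.vertex N ∈ s}) := by
  refine ⟨inter_subset_left.trans h.1, fun p hp q hq hqp => ⟨h.2 p hp.1 q hq hqp, ?_⟩⟩
  have := hp.2
  rwa [mem_ofPred_eq, ← vertex_eq_of_mem_cylinder hqp N le_rfl] at this

theorem isOpen_preimage (h : IsLevelSet T N S) :
    IsOpen (Subtype.val ⁻¹' S : Set T) := by
  have : (Subtype.val ⁻¹' S : Set T) = Subtype.val ⁻¹' (⋃ p ∈ S, p.cylinder N) := by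
    ext q
    simp only [mem_preimage, mem_iUnion]
    exact ⟨fun hq => ⟨q, hq, mem_cylinder_self _ _⟩, fun ⟨p, hp, hqp⟩ => h.2 p hp q q.2 hqp⟩
  rw [this]
  exact (isOpen_biUnion fun p _ => (isClopen_cylinder p N).isOpen).preimage
    continuous_subtype_val

theorem isClopen_preimage (h : IsLevelSet T N S) :
    IsClopen (Subtype.val ⁻¹' S : Set T) := by
  refine ⟨⟨?_⟩, h.isOpen_preimage⟩
  have : (Subtype.val ⁻¹' S : Set T)ᶜ = Subtype.val ⁻¹' (T \ S) := by
    ext q; simp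
  rw [this]
  exact h.diff.isOpen_preimage

theorem biUnion_inter (P : Finset B.PathSpace) (N : ℕ) :
    IsLevelSet T N ((⋃ p ∈ P, p.cylinder N) ∩ T) := by
  refine ⟨inter_subset_right, fun p hp q hq hqp => ⟨?_, hq⟩⟩
  obtain ⟨r, hr, hpr⟩ := mem_iUnion₂.1 hp.1
  refine mem_iUnion₂.2 ⟨r, hr, ?_⟩
  rwa [cylinder_eq_of_mem hpr] at hqp

end IsLevelSet

/-- By compactness finitely many cylinders cover the set; the largest of their levels works. -/
theorem exists_isLevelSet_of_isClopen [Finite V] {T : Set B.PathSpace} (hT : IsClosed T)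
    {U : Set T} (hU : IsClopen U) : ∃ N, IsLevelSet T N (Subtype.val '' U) := by
  have hc : IsCompact (Subtype.val '' U) :=
    (hT.isClosedEmbedding_subtypeVal.isClosedMap _ hU.isClosed).isCompact
  obtain ⟨O, hO, rfl⟩ := isOpen_induced_iff.1 hU.isOpen
  rw [Subtype.image_preimage_coe] at hc ⊢
  have hex : ∀ p ∈ T ∩ O, ∃ N, p.cylinder N ⊆ O := fun p hp => exists_cylinder_subset hO hp.2
  choose! n hn using hex
  obtain ⟨t, ht, hcov⟩ := hc.elim_nhds_subcover (fun p => p.cylinder (n p)) fun p _ =>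
    (isClopen_cylinder p _).isOpen.mem_nhds (mem_cylinder_self p _)
  refine ⟨t.sup n, inter_subset_left, fun p hp q hq hqp => ⟨hq, ?_⟩⟩
  obtain ⟨r, hr, hpr⟩ := mem_iUnion₂.1 (hcov hp)
  refine hn r (ht r hr) ?_
  rw [← cylinder_eq_of_mem hpr]
  exact cylinder_anti p (Finset.le_sup hr) hqp

theorem isGoodMeasure_onSupport_iff [Finite V] {μ : Measure B.PathSpace} :
    IsGoodMeasure (onSupport μ) ↔ ∀ (M N : ℕ) (S W : Set B.PathSpace),
      IsLevelSet μ.support M S → IsLevelSet μ.support N W → μ S < μ W →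
      ∃ (L : ℕ) (S' : Set B.PathSpace), IsLevelSet μ.support L S' ∧ S' ⊆ W ∧ μ S' = μ S := by
  have hclosed : IsClosed μ.support := Measure.isClosed_support
  have happ : ∀ U : Set μ.support, onSupport μ U = μ (Subtype.val '' U) := fun U =>
    comap_subtype_coe_apply hclosed.measurableSet μ U
  have himg : ∀ {N : ℕ} {S : Set B.PathSpace}, IsLevelSet μ.support N S →
      Subtype.val '' (Subtype.val ⁻¹' S : Set μ.support) = S := fun {N S} h => by
    rw [Subtype.image_preimage_coe, inter_eq_right.2 h.1]
  constructor
  · intro h M N S W hS hW hlt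
    obtain ⟨U, hU, hUW, hUμ⟩ := h _ hW.isClopen_preimage _ hS.isClopen_preimage
      (by rwa [happ, happ, himg hS, himg hW])
    obtain ⟨L, hL⟩ := exists_isLevelSet_of_isClopen hclosed hU
    refine ⟨L, _, hL, ?_, ?_⟩
    · rw [image_subset_iff]; exact hUW
    · rwa [happ, happ, himg hS] at hUμ
  · intro h W hW U hU hlt
    obtain ⟨N, hN⟩ := exists_isLevelSet_of_isClopen hclosed hW
    obtain ⟨M, hM⟩ := exists_isLevelSet_of_isClopen hclosed hU
    rw [happ, happ] at hlt
    obtain ⟨L, S', hS', hsub, hμ⟩ := h M N _ _ hM hN hlt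
    refine ⟨_, hS'.isClopen_preimage, ?_, by rw [happ, happ, himg hS', hμ]⟩
    intro p hp
    obtain ⟨p', hp', he⟩ := hsub hp
    exact Subtype.ext he ▸ hp'

/-! ### Choosing disjoint cylinders with prescribed end vertices. -/

section Walks

variable [Fintype V]

/-- A cylinder of level `N` ending in `v` contains one cylinder of level `N + k` ending in `b` for
every walk of length `k` from `v` to `b`. -/
theorem exists_separated_card_eq_walks (b : V) (k : ℕ) (p : B.PathSpace) (N : ℕ) :
    ∃ Q : Finset B.PathSpace, Q.card = B.walks k (p.vertex N) b ∧
      IsSeparated (Q : Set B.PathSpace) (N + k) ∧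
      ∀ q ∈ Q, q ∈ p.cylinder N ∧ q.vertex (N + k) = b := by
  classical
  induction k generalizing p N with
  | zero =>
    by_cases h : p.vertex N = b
    · refine ⟨{p}, by simp [walks, h], ?_, ?_⟩
      · intro q hq r hr _
        simp only [Finset.coe_singleton, mem_singleton_iff] at hq hr
        rw [hq, hr]
      · intro q hq
        rw [Finset.mem_singleton.1 hq]
        exact ⟨mem_cylinder_self p N, h⟩
    · exact ⟨∅, by simp [walks, h], by simp [IsSeparated], by simp⟩
  | succ k ih =>
    choose Q hcard hsep hQ using fun e => ih (p.extend N e) (N + 1)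
    have hmem : ∀ e, ∀ q ∈ Q e, q ∈ p.cylinder N ∧ q.edge N = ⟨p.vertex N, e⟩ := fun e q hq =>
      mem_cylinder_extend_iff.1 (hQ e q hq).1
    have hN : N + 1 + k = N + (k + 1) := by ring
    have hee : ∀ e e' q r, q ∈ Q e → r ∈ Q e' → q.edge N = r.edge N → e = e' := by
      intro e e' q r hq hr h
      rw [(hmem e q hq).2, (hmem e' r hr).2] at h
      exact eq_of_heq (Sigma.mk.inj h).2
    refine ⟨Finset.univ.biUnion Q, ?_, ?_, ?_⟩
    · rw [Finset.card_biUnion, walks, Fintype.sum_sigma]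
      · refine Finset.sum_congr rfl fun w _ => ?_
        simp [hcard, extend_vertex]
      · intro e _ e' _ hne
        exact Finset.disjoint_left.2 fun q hq hq' => hne (hee e e' q q hq hq' rfl)
    · intro q hq r hr hrq
      obtain ⟨e, -, hqe⟩ := Finset.mem_biUnion.1 hq
      obtain ⟨e', -, hre⟩ := Finset.mem_biUnion.1 hr
      obtain rfl : e' = e := hee _ _ r q hre hqe (hrq.2 N (by omega))
      exact hsep e' q hqe r hre (by rwa [hN])
    · intro q hq
      obtain ⟨e, -, hqe⟩ := Finset.mem_biUnion.1 hq
      exact ⟨(hmem e q hqe).1, by rw [← hN]; exact (hQ e q hqe).2⟩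

/-- Among the subcylinders of level `M + k` ending in `b`, counted by walks, select exactly `n b`.
The identity for arbitrary `f` records these multiplicities. -/
theorem exists_separated_sum_eq {P : Finset B.PathSpace} {M : ℕ}
    (hP : IsSeparated (P : Set B.PathSpace) M) (k : ℕ) {n : V → ℕ}
    (hn : ∀ b ∈ α, n b ≤ ∑ p ∈ P, B.walks k (p.vertex M) b) :
    ∃ T : Finset B.PathSpace, IsSeparated (T : Set B.PathSpace) (M + k) ∧
      (∀ q ∈ T, (∃ p ∈ P, q ∈ p.cylinder M) ∧ q.vertex (M + k) ∈ α) ∧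
      ∀ f : V → ℝ, ∑ q ∈ T, f (q.vertex (M + k)) = ∑ b ∈ α, n b * f b := by
  classical
  choose Q hcard hsep hQ using fun b p => exists_separated_card_eq_walks (B := B) b k p M
  have hpp : ∀ b b' p p' q r, p ∈ P → p' ∈ P → q ∈ Q b p → r ∈ Q b' p' →
      r ∈ q.cylinder M → p' = p := by
    intro b b' p p' q r hp hp' hq hr hrq
    refine hP p hp p' hp' ?_
    rw [← cylinder_eq_of_mem (hQ b p q hq).1, ← cylinder_eq_of_mem hrq]
    exact mem_cylinder_symm (hQ b' p' r hr).1
  have hex : ∀ b ∈ α, ∃ T ⊆ P.biUnion (Q b), T.card = n b := by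
    intro b hb
    refine Finset.exists_subset_card_eq ?_
    rw [Finset.card_biUnion]
    · simpa only [hcard] using hn b hb
    · intro p hp p' hp' hne
      exact Finset.disjoint_left.2 fun q hq hq' => hne (hpp b b p p' q q hp hp' hq hq' (mem_cylinder_self q M)).symm
  choose! T hT hTcard using hex
  have hTb : ∀ b ∈ α, ∀ q ∈ T b, q.vertex (M + k) = b := by
    intro b hb q hq
    obtain ⟨p, -, hqp⟩ := Finset.mem_biUnion.1 (hT b hb hq)
    exact (hQ b p q hqp).2
  refine ⟨α.biUnion T, ?_, ?_, ?_⟩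
  · intro q hq r hr hrq
    obtain ⟨b, hb, hqb⟩ := Finset.mem_biUnion.1 hq
    obtain ⟨b', hb', hrb⟩ := Finset.mem_biUnion.1 hr
    obtain rfl : b' = b := by
      rw [← hTb b hb q hqb, ← hTb b' hb' r hrb]
      exact vertex_eq_of_mem_cylinder hrq _ le_rfl
    obtain ⟨p, hp, hqp⟩ := Finset.mem_biUnion.1 (hT b' hb hqb)
    obtain ⟨p', hp', hrp⟩ := Finset.mem_biUnion.1 (hT b' hb' hrb)
    obtain rfl := hpp _ _ p p' q r hp hp' hqp hrp (cylinder_anti q (Nat.le_add_right M k) hrq)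
    exact hsep b' p' q hqp r hrp hrq
  · intro q hq
    obtain ⟨b, hb, hqb⟩ := Finset.mem_biUnion.1 hq
    obtain ⟨p, hp, hqp⟩ := Finset.mem_biUnion.1 (hT b hb hqb)
    exact ⟨⟨p, hp, (hQ b p q hqp).1⟩, by rwa [hTb b hb q hqb]⟩
  · intro f
    rw [Finset.sum_biUnion]
    · refine Finset.sum_congr rfl fun b hb => ?_
      rw [Finset.sum_congr rfl fun q hq => by rw [hTb b hb q hq], Finset.sum_const, hTcard b hb,
        nsmul_eq_mul]
    · intro b hb b' hb' hne
      rw [Function.onFun, Finset.disjoint_left]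
      intro q hq hq'
      exact hne ((hTb b hb q hq).symm.trans (hTb b' hb' q hq'))

end Walks

theorem exists_int_coeff {x : V → ℝ} {y : ℝ} (hy : y ∈ AddSubgroup.closure (x '' (α : Set V))) :
    ∃ c : V → ℤ, y = ∑ a ∈ α, (c a : ℝ) * x a := by
  classical
  induction hy using AddSubgroup.closure_induction with
  | mem y hy =>
    obtain ⟨a, ha, rfl⟩ := hy
    have ha' : a ∈ α := ha
    exact ⟨fun b => if b = a then 1 else 0, by simp [ha']⟩
  | zero => exact ⟨0, by simp⟩
  | add y z _ _ hy hz =>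
    obtain ⟨c, rfl⟩ := hy
    obtain ⟨d, rfl⟩ := hz
    exact ⟨c + d, by simp [add_mul, Finset.sum_add_distrib]⟩
  | neg y _ hy =>
    obtain ⟨c, rfl⟩ := hy
    exact ⟨-c, by simp⟩

/-- The group generated by fractions `p a / q` consists of the multiples of `gcd p / q`. -/
theorem natCast_div_mem_closure_iff {x : V → ℝ} {p : V → ℕ} {q : ℕ} (hq : 0 < q)
    (hx : ∀ a ∈ α, x a = (p a : ℝ) / (q : ℝ)) (m : ℕ) :
    (m : ℝ) / q ∈ AddSubgroup.closure (x '' (α : Set V)) ↔ α.gcd p ∣ m := by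
  have hq' : (q : ℝ) ≠ 0 := by positivity
  let φ : ℤ →+ ℝ := (AddMonoidHom.mulRight ((q : ℝ)⁻¹)).comp (Int.castAddHom ℝ)
  have hφ : ∀ n : ℤ, φ n = (n : ℝ) / q := fun n => (div_eq_mul_inv _ _).symm
  constructor
  · intro h
    have hle : AddSubgroup.closure (x '' (α : Set V)) ≤
        (AddSubgroup.zmultiples ((α.gcd p : ℕ) : ℤ)).map φ := by
      rw [AddSubgroup.closure_le]
      rintro _ ⟨a, ha, rfl⟩
      refine ⟨p a, Int.mem_zmultiples_iff.2
        (Int.natCast_dvd_natCast.2 (Finset.gcd_dvd (Finset.mem_coe.1 ha))), ?_⟩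
      rw [hφ, hx a ha, Int.cast_natCast]
    obtain ⟨n, hn, hnm⟩ := hle h
    rw [hφ, div_left_inj' hq'] at hnm
    obtain rfl : n = m := by exact_mod_cast hnm
    exact Int.natCast_dvd_natCast.1 (Int.mem_zmultiples_iff.1 hn)
  · intro h
    obtain ⟨d, hd⟩ := Int.subgroup_cyclic ((AddSubgroup.closure (x '' (α : Set V))).comap φ)
    rw [← AddSubgroup.zmultiples_eq_closure] at hd
    have hdg : d.natAbs ∣ α.gcd p := by
      refine Finset.dvd_gcd fun a ha => ?_
      rw [← Int.natCast_dvd_natCast, Int.natAbs_dvd, ← Int.mem_zmultiples_iff, ← hd,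
        AddSubgroup.mem_comap, hφ, Int.cast_natCast, ← hx a ha]
      exact AddSubgroup.subset_closure (mem_image_of_mem x (Finset.mem_coe.2 ha))
    have hmem : (m : ℤ) ∈ (AddSubgroup.closure (x '' (α : Set V))).comap φ := by
      rw [hd, Int.mem_zmultiples_iff, ← Int.natAbs_dvd, Int.natCast_dvd_natCast]
      exact hdg.trans h
    rwa [AddSubgroup.mem_comap, hφ, Int.cast_natCast] at hmem

/-! ### Values of `μ` on clopen sets and the criterion for goodness. -/

section Values

variable [Fintype V] {μ : Measure B.PathSpace} {lam : ℝ} {x : V → ℝ}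

namespace IsDefinedBy

variable (hdef : B.IsDefinedBy μ α lam x)
include hdef

theorem measure_biUnion_of_isSeparated (hlam : 0 < lam) {P : Finset B.PathSpace} {N : ℕ}
    (hP : IsSeparated (P : Set B.PathSpace) N)
    (hv : ∀ p ∈ P, p.vertex N ∈ B.finiteVertices μ α) :
    μ (⋃ p ∈ P, p.cylinder N) = ENNReal.ofReal ((∑ p ∈ P, x (p.vertex N)) / lam ^ N) := by
  rw [hP.measure_biUnion μ, Finset.sum_div, ENNReal.ofReal_sum_of_nonneg]
  · exact Finset.sum_congr rfl fun p hp => hdef.measure_cylinder_eq hlam p N (hv p hp)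
  · exact fun p hp => div_nonneg (hdef.pos _ (hv p hp)).le (pow_pos hlam N).le

/-- Up to a null set, `S` contains the whole cylinder of each of its paths, so finiteness of `μ S`
passes to the cylinders. -/
theorem vertex_mem_of_isLevelSet (hlam : 0 < lam) {N : ℕ} {S : Set B.PathSpace}
    (hS : IsLevelSet (B.pathsReaching α) N S) (hfin : μ S < ⊤) {p : B.PathSpace} (hp : p ∈ S) :
    p.vertex N ∈ B.finiteVertices μ α := by
  refine hdef.mem_finiteVertices_of_lt_top hlam (hS.1 hp N) (lt_of_le_of_lt ?_ hfin)
  rw [← measure_inter_conull (s := p.cylinder N) hdef.measure_compl_pathsReaching]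
  exact measure_mono fun q hq => hS.2 p hp q hq.2 hq.1

theorem exists_measure_eq (hlam : 0 < lam) {N : ℕ} {S : Set B.PathSpace}
    (hS : IsLevelSet (B.pathsReaching α) N S)
    (hv : ∀ p ∈ S, p.vertex N ∈ B.finiteVertices μ α) :
    ∃ P : Finset B.PathSpace, (P : Set B.PathSpace) ⊆ S ∧ IsSeparated (P : Set B.PathSpace) N ∧
      μ S = ENNReal.ofReal ((∑ p ∈ P, x (p.vertex N)) / lam ^ N) := by
  obtain ⟨P, hPS, hsep, hcov⟩ := exists_representatives S N
  refine ⟨P, hPS, hsep, ?_⟩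
  rw [← hdef.measure_biUnion_of_isSeparated hlam hsep fun p hp => hv p (hPS hp)]
  refine le_antisymm (measure_mono hcov) ?_
  rw [← measure_inter_conull (s := ⋃ p ∈ P, p.cylinder N) hdef.measure_compl_pathsReaching]
  refine measure_mono fun q hq => ?_
  obtain ⟨p, hp, hqp⟩ := mem_iUnion₂.1 hq.1
  exact hS.2 p (hPS hp) q hq.2 hqp

theorem tendsto_measure_inter_vertex {S : Set B.PathSpace} (hS : S ⊆ B.pathsReaching α) :
    Tendsto (fun M => μ (S ∩ {p | p.vertex M ∈ α})) atTop (𝓝 (μ S)) := by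
  have hmono : Monotone fun M => S ∩ {p | p.vertex M ∈ α} := fun M N hMN p hp =>
    ⟨hp.1, hdef.isVertexClass.vertex_mem (hS hp.1) hMN hp.2⟩
  have hU : μ (⋃ M, S ∩ {p | p.vertex M ∈ α}) = μ S := by
    refine le_antisymm (measure_mono (iUnion_subset fun M => inter_subset_left)) ?_
    rw [← measure_inter_conull (s := S) hdef.compl_null]
    refine measure_mono ?_
    rintro p ⟨hp, M, hM⟩
    exact mem_iUnion.2 ⟨M, hp, hM M le_rfl⟩
  rw [← hU]
  exact tendsto_measure_iUnion_atTop hmono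

theorem lam_mul_mem_closure {y : ℝ} (hy : y ∈ AddSubgroup.closure (x '' (α : Set V))) :
    lam * y ∈ AddSubgroup.closure (x '' (α : Set V)) := by
  induction hy using AddSubgroup.closure_induction with
  | mem y hy =>
    obtain ⟨a, ha, rfl⟩ := hy
    rw [← hdef.sum_F_mul ha]
    refine sum_mem fun w hw => ?_
    rw [← nsmul_eq_mul]
    exact nsmul_mem (AddSubgroup.subset_closure (mem_image_of_mem x hw)) _
  | zero => simp
  | add y z _ _ hy hz => rw [mul_add]; exact add_mem hy hz
  | neg y _ hy => rw [mul_neg]; exact neg_mem hy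

theorem pow_mul_mem_closure {y : ℝ} {m n : ℕ} (hmn : m ≤ n)
    (hy : lam ^ m * y ∈ AddSubgroup.closure (x '' (α : Set V))) :
    lam ^ n * y ∈ AddSubgroup.closure (x '' (α : Set V)) := by
  induction n, hmn using Nat.le_induction with
  | base => exact hy
  | succ n _ ih =>
    rw [pow_succ', mul_assoc]
    exact hdef.lam_mul_mem_closure ih

theorem exists_pow_mul_mem_of_isGoodMeasure (hinf : μ univ = ⊤)
    (hgood : IsGoodMeasure (onSupport μ)) {v : V} (hv : v ∈ B.finiteVertices μ α) :
    ∃ R : ℕ, lam ^ R * x v ∈ AddSubgroup.closure (x '' (α : Set V)) := by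
  have hlam := hdef.lam_pos hinf
  rw [isGoodMeasure_onSupport_iff, hdef.support_eq hlam] at hgood
  set D := B.pathsReaching α with hD
  have hnull := hdef.measure_compl_pathsReaching
  obtain ⟨p, rfl⟩ := exists_vertex_zero (B := B) v
  have hp : IsLevelSet D 0 (p.cylinder 0 ∩ D) := by
    have := IsLevelSet.biUnion_inter (T := D) {p} 0
    simpa using this
  have hpμ : μ (p.cylinder 0 ∩ D) = ENNReal.ofReal (x (p.vertex 0)) := by
    rw [measure_inter_conull hnull, hdef.measure_cylinder_eq hlam p 0 hv]
    simp
  have hDμ : μ D = ⊤ := by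
    rw [← univ_inter D, measure_inter_conull hnull, hinf]
  have ht := hdef.tendsto_measure_inter_vertex (S := D) Subset.rfl
  rw [hDμ] at ht
  -- Infinite total mass enters here: the paths in `α` at level `N` outweigh the given cylinder.
  obtain ⟨N, hN⟩ := (ht.eventually_const_lt (hpμ ▸ ENNReal.ofReal_lt_top)).exists
  have hDl : IsLevelSet D N D := ⟨Subset.rfl, fun _ _ _ hq _ => hq⟩
  obtain ⟨L, S, hS, hSW, hSμ⟩ := hgood 0 N _ _ hp (hDl.inter_vertex (α : Set V)) hN
  have hS' := hS.mono (le_max_left L N)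
  have hSα : ∀ q ∈ S, q.vertex (max L N) ∈ α := fun q hq =>
    hdef.isVertexClass.vertex_mem (hS.1 hq) (le_max_right L N) (hSW hq).2
  obtain ⟨P, hPS, -, hPμ⟩ := hdef.exists_measure_eq hlam hS' fun q hq =>
    hdef.subset_finiteVertices (hSα q hq)
  rw [hSμ, hpμ] at hPμ
  have hnn : 0 ≤ (∑ q ∈ P, x (q.vertex (max L N))) / lam ^ max L N :=
    div_nonneg (Finset.sum_nonneg fun q hq => (hdef.pos_of_mem (hSα q (hPS hq))).le)
      (pow_pos hlam _).le
  refine ⟨max L N, ?_⟩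
  rw [(ENNReal.ofReal_eq_ofReal_iff (hdef.pos _ hv).le hnn).1 hPμ,
    mul_div_cancel₀ _ (pow_pos hlam _).ne']
  exact sum_mem fun q hq =>
    AddSubgroup.subset_closure (mem_image_of_mem x (Finset.mem_coe.2 (hSα q (hPS hq))))

theorem isGoodMeasure_of_pow_mul_mem (herg : B.IsTailErgodic μ) (hinf : μ univ = ⊤) {R : ℕ}
    (hR : ∀ v ∈ B.finiteVertices μ α, lam ^ R * x v ∈ AddSubgroup.closure (x '' (α : Set V))) :
    IsGoodMeasure (onSupport μ) := by
  classical
  have hlam := hdef.lam_pos hinf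
  rw [isGoodMeasure_onSupport_iff, hdef.support_eq hlam]
  set D := B.pathsReaching α with hD
  intro N₁ N₂ S W hS hW hlt
  -- The null case is separate since the coefficients below become positive only when `t > 0`.
  rcases eq_or_ne (μ S) 0 with h0 | h0
  · exact ⟨0, ∅, ⟨empty_subset _, by simp⟩, empty_subset _, by rw [h0, measure_empty]⟩
  obtain ⟨P, hPS, -, hPμ⟩ := hdef.exists_measure_eq hlam hS fun p hp =>
    hdef.vertex_mem_of_isLevelSet hlam hS hlt.lt_top hp
  set s := ∑ p ∈ P, x (p.vertex N₁) with hs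
  have hsmem : lam ^ R * s ∈ AddSubgroup.closure (x '' (α : Set V)) := by
    rw [hs, Finset.mul_sum]
    exact sum_mem fun p hp => hR _ (hdef.vertex_mem_of_isLevelSet hlam hS hlt.lt_top (hPS hp))
  -- `M ≥ N₁ + R` puts `lam ^ M * t` in the group, `M ≥ N₂` keeps `W` a level set, and the part of
  -- `W` in `α` at level `M` still exceeds `μ S`.
  obtain ⟨M, hM1, hM2, hMlt⟩ := ((eventually_ge_atTop (N₁ + R)).and
    ((eventually_ge_atTop N₂).and
      ((hdef.tendsto_measure_inter_vertex hW.1).eventually_const_lt hlt))).exists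
  have hWM := (hW.mono hM2).inter_vertex (α : Set V)
  have hWv : ∀ p ∈ W ∩ {p | p.vertex M ∈ (α : Set V)}, p.vertex M ∈ α := fun p hp => hp.2
  obtain ⟨Q, hQW, hQsep, hQμ⟩ := hdef.exists_measure_eq hlam hWM fun p hp =>
    hdef.subset_finiteVertices (hWv p hp)
  have hQα : ∀ q ∈ Q, q.vertex M ∈ α := fun q hq => hWv q (hQW hq)
  have hQμ' : μ S < ENNReal.ofReal ((∑ p ∈ Q, x (p.vertex M)) / lam ^ M) := by
    rw [← hQμ]; exact hMlt
  set t := s / lam ^ N₁ with ht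
  have ht0 : 0 < t := by
    rw [hPμ] at h0
    exact ENNReal.ofReal_pos.1 (pos_iff_ne_zero.2 h0)
  have htQ : lam ^ M * t < ∑ p ∈ Q, x (p.vertex M) := by
    rw [hPμ] at hQμ'
    have := (ENNReal.ofReal_lt_ofReal_iff_of_nonneg ht0.le).1 hQμ'
    rwa [lt_div_iff₀' (pow_pos hlam M)] at this
  have htmem : lam ^ M * t ∈ AddSubgroup.closure (x '' (α : Set V)) := by
    have e : lam ^ M * t = lam ^ (M - N₁) * s := by
      rw [ht, ← Nat.add_sub_cancel' (show N₁ ≤ M by omega), pow_add, Nat.add_sub_cancel_left]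
      field_simp
    rw [e]
    exact hdef.pow_mul_mem_closure (by omega) hsmem
  obtain ⟨c, hc⟩ := exists_int_coeff htmem
  have hfib : ∀ f : V → ℝ, ∑ p ∈ Q, f (p.vertex M) =
      ∑ a ∈ α, ((Q.filter fun p => p.vertex M = a).card : ℝ) * f a := by
    intro f
    rw [← Finset.sum_fiberwise_of_maps_to hQα]
    refine Finset.sum_congr rfl fun a _ => ?_
    rw [Finset.sum_congr rfl fun p hp => by rw [(Finset.mem_filter.1 hp).2], Finset.sum_const,
      nsmul_eq_mul]
  obtain ⟨K, hK⟩ := hdef.eventually_sum_mul_walks_pos herg hinf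
  -- The pairing of `c` with `x` is `lam ^ M * t > 0`; that of the surplus in `hev2` is positive by
  -- `htQ`.
  have hev1 := (Finset.eventually_all α).2 (hK (fun a => (c a : ℝ))
    (by rw [← hc]; exact mul_pos (pow_pos hlam M) ht0))
  have hev2 := (Finset.eventually_all α).2
    (hK (fun a => ((Q.filter fun p => p.vertex M = a).card : ℝ) - c a) (by
      simp only [sub_mul, Finset.sum_sub_distrib, ← hfib, ← hc]
      linarith))
  obtain ⟨j, hj1, hj2⟩ := (hev1.and hev2).exists
  set L := K * j + K with hL
  -- Positivity of the transported coefficients means that `toNat` loses nothing.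
  have hn : ∀ b ∈ α, (((∑ a ∈ α, c a * B.walks L a b : ℤ).toNat : ℕ) : ℝ) =
      ∑ a ∈ α, (c a : ℝ) * B.walks L a b := by
    intro b hb
    have h1 := hj1 b hb
    have h2 : (0 : ℤ) < ∑ a ∈ α, c a * B.walks L a b := by exact_mod_cast h1
    rw [← Int.cast_natCast, Int.toNat_of_nonneg h2.le]
    push_cast
    rfl
  obtain ⟨T, hTsep, hT, hTsum⟩ := exists_separated_sum_eq (α := α) hQsep L
    (n := fun b => (∑ a ∈ α, c a * B.walks L a b : ℤ).toNat) (fun b hb => by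
      have h1 := hj2 b hb
      simp only [sub_mul, Finset.sum_sub_distrib, ← hn b hb] at h1
      rw [← hfib fun a => (B.walks L a b : ℝ)] at h1
      exact_mod_cast (sub_pos.1 h1).le)
  refine ⟨M + L, (⋃ p ∈ T, p.cylinder (M + L)) ∩ D, IsLevelSet.biUnion_inter T _, ?_, ?_⟩
  · rintro q ⟨hq, hqD⟩
    obtain ⟨r, hr, hqr⟩ := mem_iUnion₂.1 hq
    obtain ⟨p, hp, hrp⟩ := (hT r hr).1
    refine (hW.mono hM2).2 p (hQW hp).1 q hqD ?_
    rw [← cylinder_eq_of_mem hrp]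
    exact cylinder_anti r (Nat.le_add_right M L) hqr
  · rw [measure_inter_conull hdef.measure_compl_pathsReaching,
      hdef.measure_biUnion_of_isSeparated hlam hTsep fun q hq =>
        hdef.subset_finiteVertices (hT q hq).2, hPμ, hTsum]
    congr 1
    have e : ∑ b ∈ α, (((∑ a ∈ α, c a * B.walks L a b : ℤ).toNat : ℕ) : ℝ) * x b =
        lam ^ L * (lam ^ M * t) := by
      rw [Finset.sum_congr rfl fun b hb => by rw [hn b hb, Finset.sum_mul], Finset.sum_comm, hc,
        Finset.mul_sum]
      refine Finset.sum_congr rfl fun a ha => ?_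
      rw [mul_left_comm, ← hdef.sum_walks_mul L ha, Finset.mul_sum]
      exact Finset.sum_congr rfl fun b _ => by ring
    clear_value L
    rw [e, pow_add]
    field_simp

theorem isGoodMeasure_iff (herg : B.IsTailErgodic μ) (hinf : μ univ = ⊤) :
    IsGoodMeasure (onSupport μ) ↔ ∃ R : ℕ, ∀ v ∈ B.finiteVertices μ α, v ∉ α →
      lam ^ R * x v ∈ AddSubgroup.closure (x '' (α : Set V)) := by
  constructor
  · intro h
    choose! R hR using fun v => hdef.exists_pow_mul_mem_of_isGoodMeasure hinf h (v := v)
    exact ⟨(B.finiteVertices μ α).sup R, fun v hv _ =>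
      hdef.pow_mul_mem_closure (Finset.le_sup hv) (hR v hv)⟩
  · rintro ⟨R, hR⟩
    refine hdef.isGoodMeasure_of_pow_mul_mem herg hinf (R := R) fun v hv => ?_
    by_cases hvα : v ∈ α
    · refine hdef.pow_mul_mem_closure (Nat.zero_le R) ?_
      simpa using AddSubgroup.subset_closure (mem_image_of_mem x (Finset.mem_coe.2 hvα))
    · exact hR v hv hvα

theorem exists_natCast_eq_lam (hlam : 0 < lam) {p : V → ℕ} {q : ℕ} (hq : 0 < q)
    (hx : ∀ v ∈ B.finiteVertices μ α, x v = (p v : ℝ) / (q : ℝ))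
    (hgcd : (B.finiteVertices μ α).gcd p = 1) : ∃ l : ℕ, lam = (l : ℝ) := by
  set I := B.finiteVertices μ α with hI
  have hq' : (q : ℝ) ≠ 0 := by positivity
  have hm : ∀ v ∈ I, lam * p v = ((∑ w ∈ I, B.F w v * p w : ℕ) : ℝ) := by
    intro v hv
    have h := hdef.eigen v hv
    rw [Finset.sum_congr rfl fun w hw => by rw [hx w hw, A_apply, ← mul_div_assoc],
      ← Finset.sum_div, hx v hv, ← mul_div_assoc, div_left_inj' hq'] at h
    rw [← h]
    push_cast
    rfl
  obtain ⟨a, ha⟩ := hdef.isVertexClass.nonempty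
  have haI := hdef.subset_finiteVertices ha
  have hpa : (p a : ℝ) ≠ 0 := by
    intro h0
    have := hdef.pos a haI
    rw [hx a haI, h0, zero_div] at this
    exact lt_irrefl _ this
  obtain ⟨r, hr⟩ : ∃ r : ℚ, lam = (r : ℝ) := by
    refine ⟨((∑ w ∈ I, B.F w a * p w : ℕ) : ℚ) / p a, ?_⟩
    rw [Rat.cast_div, Rat.cast_natCast, Rat.cast_natCast, ← hm a haI, mul_div_cancel_right₀ _ hpa]
  -- Each `r * p v` is an integer and `r` is in lowest terms, so its denominator divides every `p
  -- v`.
  have hden : r.den ∣ I.gcd p := by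
    refine Finset.dvd_gcd fun v hv => ?_
    have h1 := hm v hv
    rw [hr] at h1
    have h2 : r * (p v : ℚ) = ((∑ w ∈ I, B.F w v * p w : ℕ) : ℚ) := by exact_mod_cast h1
    rw [← Rat.num_div_den r, div_mul_eq_mul_div, div_eq_iff (by exact_mod_cast r.den_nz)] at h2
    have h3 : r.num * (p v : ℤ) = ((∑ w ∈ I, B.F w v * p w : ℕ) : ℤ) * r.den := by
      exact_mod_cast h2
    have h4 : (r.den : ℤ) ∣ r.num * p v := ⟨_, h3.trans (mul_comm _ _)⟩
    have h5 : r.den ∣ r.num.natAbs * p v := by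
      have := Int.natAbs_dvd_natAbs.2 h4
      rwa [Int.natAbs_mul, Int.natAbs_natCast, Int.natAbs_natCast] at this
    exact r.reduced.symm.dvd_of_dvd_mul_left h5
  rw [hgcd, Nat.dvd_one] at hden
  have hr0 : 0 < r := by rw [hr] at hlam; exact_mod_cast hlam
  refine ⟨r.num.toNat, ?_⟩
  rw [hr, ← Int.cast_natCast, Int.toNat_of_nonneg (Rat.num_pos.2 hr0).le]
  exact_mod_cast (Rat.den_eq_one_iff r).1 hden |>.symm

end IsDefinedBy

end Values

end StationaryBratteliDiagram

theorem mainTheorem10 {V : Type u} [Fintype V] (B : StationaryBratteliDiagram V)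
    (μ : Measure B.PathSpace)
    (hatom : ∀ p : B.PathSpace, μ {p} = 0)
    (hinv : B.IsTailInvariant μ) (herg : B.IsTailErgodic μ) (hinf : μ Set.univ = ⊤)
    (α : Finset V) (lam : ℝ) (x : V → ℝ) (hdef : B.IsDefinedBy μ α lam x) :
    (IsGoodMeasure (onSupport μ) ↔
      ∃ R : ℕ, ∀ v ∈ B.finiteVertices μ α, v ∉ α →
        lam ^ R * x v ∈ AddSubgroup.closure (x '' (α : Set V))) ∧
    (clopenValues (onSupport μ) ⊆ Set.range (fun r : ℚ => (r : ℝ)) →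
      ∀ (p : V → ℕ) (q : ℕ), 0 < q →
        (∀ v ∈ B.finiteVertices μ α, x v = (p v : ℝ) / (q : ℝ)) →
        (B.finiteVertices μ α).gcd p = 1 →
        ∃ l : ℕ, lam = (l : ℝ) ∧
          (IsGoodMeasure (onSupport μ) ↔ ∃ R : ℕ, α.gcd p ∣ l ^ R)) := by
  have hiff := hdef.isGoodMeasure_iff herg hinf
  refine ⟨hiff, fun _ p q hq hx hgcd => ?_⟩
  obtain ⟨l, rfl⟩ := hdef.exists_natCast_eq_lam (hdef.lam_pos hinf) hq hx hgcd
  refine ⟨l, rfl, hiff.trans (exists_congr fun R => ?_)⟩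
  have hmem : ∀ v ∈ B.finiteVertices μ α,
      ((l : ℝ) ^ R * x v ∈ AddSubgroup.closure (x '' (α : Set V)) ↔ α.gcd p ∣ l ^ R * p v) := by
    intro v hv
    rw [← StationaryBratteliDiagram.natCast_div_mem_closure_iff hq fun a ha =>
        hx a (hdef.subset_finiteVertices ha),
      hx v hv]
    push_cast
    rw [mul_div_assoc]
  constructor
  · intro h
    -- Vertices of `α` satisfy the divisibility automatically, and the gcd over all of `V_f` equals
    -- `l ^ R`.
    have hall : α.gcd p ∣ (B.finiteVertices μ α).gcd fun v => l ^ R * p v := by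
      refine Finset.dvd_gcd fun v hv => ?_
      by_cases hvα : v ∈ α
      · exact (Finset.gcd_dvd hvα).mul_left _
      · exact (hmem v hv).1 (h v hv hvα)
    rwa [Finset.gcd_mul_left, hgcd, mul_one, normalize_eq] at hall
  · exact fun h v hv _ => (hmem v hv).2 (h.mul_right _)
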